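/- Let $a,x,p$ be real numbers with $a>0$ and let $\alpha\ge 0$ be an integer. Assume $am+n+x>0$ and $(am+n+x)^2+p>0$ for all integers $m,n\ge 1$. Definitions. Let $T=\{\lambda_i\}_{i\in I}$ be an infinite family of positive real numbers with positive integer multiplicities $\rho_i$, with no finite accumulation point, and of finite exponent of convergence $s_0=\inf\{\sigma\ge 0:\sum_i\rho_i\lambda_i^{-\sigma}<\infty\}<\infty$. Its genus $q$ is the least integer $q\ge 0$ with $\sum_i\rho_i\lambda_i^{-q-1}<\infty$; its heat function is $f(t,T)=1+\sum_i\rho_i e^{-\lambda_i t}$, $t>0$; its zeta function is $\zeta(s,T)=\sum_i\rho_i\lambda_i^{-s}$, $\Re s>s_0$; and its Fredholm determinant is $$F(z,T)=\prod_i\Big[\Big(1+\frac{z}{\lambda_i}\Big)\exp\Big(\sum_{j=1}^{q}\frac{(-1)^j}{j}\frac{z^j}{\lambda_i^j}\Big)\Big]^{\rho_i},\qquad z\in\mathbb{C}.$$ $T$ is of spectral type if $f(t,T)$ has a full asymptotic expansion as $t\to0^+$ in real powers of $t$ and such powers times positive integer powers of $\log t$, that is, $f(t,T)\sim\sum_{j=0}^\infty\sum_{k=0}^{K_j}c_{jk}\,t^{\delta_j}\log^k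 t$ with real exponents $\delta_0<\delta_1<\cdots\to\infty$. It is simply regular if, moreover, $\zeta(s,T)$ extends to a meromorphic function on $\mathbb{C}$ all of whose poles are simple. Statement. (1) The double sequence $S_p=\{(am+n+x)^2+p\}_{m,n\ge1}$, where the element of index $(m,n)$ has multiplicity $n^\alpha$, is a simply regular sequence of spectral type. (2) Let $L=\{am+n+x\}_{m,n\ge1}$ and $S_0=\{(am+n+x)^2\}_{m,n\ge1}$, both with multiplicity $n^\alpha$. The products defining $F(z,L)$ and $F(z,S_0)$ converge unconditionally for every $z\in\mathbb{C}$, and $$F(iz,L)\,F(-iz,L)=F(z^2,S_0)\qquad\text{for all } z\in\mathbb{C}.$$ -/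

import Mathlib

open Filter Topology

noncomputable section

namespace SpectralSeq

/-! A sequence of positive numbers is a family `lam : ι → ℝ`; the number `lam i` is counted
`mult i` times. All sums and products over the sequence are weighted by this multiplicity. -/

variable {ι : Type*}

/-- The Dirichlet series `∑ mult i * (lam i) ^ (-σ)` converges at the real point `σ`. -/
def DirichletSummable (lam : ι → ℝ) (mult : ι → ℕ) (σ : ℝ) : Prop :=
  Summable fun i => (mult i : ℝ) * lam i ^ (-σ)

/-- The exponent of convergence. -/
def exponent (lam : ι → ℝ) (mult : ι → ℕ) : ℝ :=
  sInf {σ : ℝ | 0 ≤ σ ∧ DirichletSummable lam mult σ}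

/-- The genus: the least natural number `q` such that `∑ mult i / (lam i) ^ (q + 1)` converges. -/
def genus (lam : ι → ℝ) (mult : ι → ℕ) : ℕ :=
  sInf {q : ℕ | Summable fun i => (mult i : ℝ) / lam i ^ (q + 1)}

/-- The heat function `f(t) = 1 + ∑ mult i * exp (-(lam i) t)`. -/
def heat (lam : ι → ℝ) (mult : ι → ℕ) (t : ℝ) : ℝ :=
  1 + ∑' i, (mult i : ℝ) * Real.exp (-lam i * t)

/-- The factors of the Fredholm determinant,
`((1 + z / lam i) * exp (∑_{j = 1}^q ((-1)^j / j) * z^j / (lam i)^j)) ^ (mult i)`,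
where `q` is the genus. -/
def fredholmFactor (lam : ι → ℝ) (mult : ι → ℕ) (z : ℂ) (i : ι) : ℂ :=
  ((1 + z / (lam i : ℂ)) *
    Complex.exp (∑ j ∈ Finset.Icc 1 (genus lam mult),
      ((-1 : ℂ) ^ j / (j : ℂ)) * (z ^ j / (lam i : ℂ) ^ j))) ^ mult i

/-- The Fredholm determinant `F(z)`. -/
def fredholm (lam : ι → ℝ) (mult : ι → ℕ) (z : ℂ) : ℂ :=
  ∏' i, fredholmFactor lam mult z i

/-- `f` has a full asymptotic expansion, for `t → 0⁺`, in real powers of `t` and real powers of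
`t` times positive integer powers of `log t`:
`f(t) ~ ∑_j ∑_{k ≤ K j} c j k * t ^ (δ j) * (log t) ^ k` with `δ j` increasing to infinity. -/
def HasPowerLogExpansion (f : ℝ → ℝ) : Prop :=
  ∃ (δ : ℕ → ℝ) (K : ℕ → ℕ) (c : ℕ → ℕ → ℝ),
    StrictMono δ ∧ Tendsto δ atTop atTop ∧
    ∀ N : ℕ,
      (fun t : ℝ => f t - ∑ j ∈ Finset.range (N + 1), ∑ k ∈ Finset.range (K j + 1),
          c j k * t ^ δ j * Real.log t ^ k)
        =o[𝓝[>] (0 : ℝ)] (fun t : ℝ => t ^ δ N)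

/-- Sequences of spectral type: infinite sequences of positive numbers, with unique accumulation
point at infinity and with finite exponent of convergence, whose heat function has an asymptotic
expansion for small `t` in powers of `t` and powers of `t` times powers of `log t`. -/
structure IsSpectralType (lam : ι → ℝ) (mult : ι → ℕ) : Prop where
  infinite : Infinite ι
  pos : ∀ i, 0 < lam i
  mult_pos : ∀ i, 0 < mult i
  tendsto : Tendsto lam cofinite atTop
  finite_exponent : ∃ σ : ℝ, 0 ≤ σ ∧ DirichletSummable lam mult σ
  heat_expansion : HasPowerLogExpansion (heat lam mult)

/-- Simply regular sequences of spectral type: the zeta function `∑ mult i * (lam i) ^ (-s)`,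
defined by this series for `Re s` larger than the exponent of convergence, continues to a
meromorphic function on the complex plane with at most simple poles. -/
structure IsSimplyRegular (lam : ι → ℝ) (mult : ι → ℕ) : Prop
    extends IsSpectralType lam mult where
  zeta_continuation : ∃ Z : ℂ → ℂ,
    (∀ s : ℂ, exponent lam mult < s.re →
      HasSum (fun i => (mult i : ℂ) * (lam i : ℂ) ^ (-s)) (Z s)) ∧
    (∀ s : ℂ, MeromorphicAt Z s) ∧
    (∀ s : ℂ, -1 ≤ meromorphicOrderAt Z s)

end SpectralSeq

/-! The pair of natural numbers `i = (i.1, i.2)` stands for the indices `m = i.1 + 1`,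
`n = i.2 + 1`, so that `m, n ≥ 1`. -/

/-- The double sequence `L = {a m + n + x}`, `m, n ≥ 1`. -/
def seqL (a x : ℝ) (i : ℕ × ℕ) : ℝ :=
  a * ((i.1 : ℝ) + 1) + ((i.2 : ℝ) + 1) + x

/-- The double sequence `S_p = {(a m + n + x)² + p}`, `m, n ≥ 1`. -/
def seqS (a x p : ℝ) (i : ℕ × ℕ) : ℝ :=
  (a * ((i.1 : ℝ) + 1) + ((i.2 : ℝ) + 1) + x) ^ 2 + p

/-- The multiplicity `n ^ α`. -/
def multN (α : ℕ) (i : ℕ × ℕ) : ℕ := (i.2 + 1) ^ α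

end

namespace SpectralSeq

/-! Convergence is settled by comparing with m + n: L is of order m + n and S_p of order (m + n)².
With weight n^α, a sequence of order (m + n)^ρ has a Dirichlet series convergent at σ ≥ 0 exactly
when ρσ > α + 2. Hence L has genus α + 2 and S_0 has genus ⌊α/2⌋ + 1, which is half the genus of L
rounded down. For this reason the exponential factors at iz and -iz multiply exactly to those of S_0
at z²: odd powers cancel and even powers double. The product formula therefore holds factor by
factor (`fredholmFactor_mul_eq_sq`), and unconditional convergence gives part (2).

For part (1), geometric series sum ∑ n^α exp(-λw) over L in closed form, as h(w) / w^(α + 2) with h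
analytic at 0 (`exists_hasSum_exp_seqL`). A Gaussian is a superposition of exponentials along a
vertical line, so ∑ n^α exp(-(λε)²) is an integral of h(εv) / (εv)^(α + 2) over Re v = 2. Expanding
h at 0 under the integral gives an expansion in powers of ε (`exists_hasPowerExpansion_gaussian`).
The shift by p only multiplies by exp(-pε²), and ε = √t gives powers t^((k - α - 2)/2) without
logarithms.

Each such power contributes one simple pole to the Mellin transform (`exists_mellin_continuation`).
Dividing by Γ(s), whose reciprocal is entire, yields the zeta function. -/

/-! ### Convergence of double sequences comparable to a power of m + n. -/

/-- The size `m + n` of the pair of positive integers `(m, n) = (i.1 + 1, i.2 + 1)`. -/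
def pairSize (i : ℕ × ℕ) : ℝ := ((i.1 : ℝ) + 1) + ((i.2 : ℝ) + 1)

lemma two_le_pairSize (i : ℕ × ℕ) : 2 ≤ pairSize i := by
  unfold pairSize
  have := Nat.cast_nonneg (α := ℝ) i.1
  have := Nat.cast_nonneg (α := ℝ) i.2
  linarith

lemma pairSize_pos (i : ℕ × ℕ) : 0 < pairSize i := by linarith [two_le_pairSize i]

lemma multN_pos (α : ℕ) (i : ℕ × ℕ) : 0 < multN α i := pow_pos (Nat.succ_pos _) _

lemma tendsto_pairSize : Tendsto pairSize cofinite atTop := by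
  refine tendsto_atTop.2 fun B => ?_
  obtain ⟨N, hN⟩ := exists_nat_ge B
  refine (Set.finite_Iic (N, N)).subset fun i hi => ?_
  simp only [Set.mem_compl_iff, Set.mem_ofPred_eq, not_le, pairSize] at hi
  have h1 := Nat.cast_nonneg (α := ℝ) i.1
  have h2 := Nat.cast_nonneg (α := ℝ) i.2
  constructor
  · have : (i.1 : ℝ) ≤ N := by linarith
    exact_mod_cast this
  · have : (i.2 : ℝ) ≤ N := by linarith
    exact_mod_cast this

lemma tendsto_of_pairSize_le {lam : ℕ × ℕ → ℝ} {c : ℝ} {ρ : ℕ} (hc : 0 < c) (hρ : ρ ≠ 0)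
    (h : ∀ i, c * pairSize i ^ ρ ≤ lam i) : Tendsto lam cofinite atTop :=
  tendsto_atTop_mono h
    (((tendsto_pow_atTop hρ).comp tendsto_pairSize).const_mul_atTop hc)

/-- The weight is at most (m + n)^α, so terms are bounded by a multiple of (m + n)^(-2τ) with τ > 1.
Splitting the exponent evenly bounds this by m^(-τ) n^(-τ), a product of convergent series. -/
lemma summable_of_pairSize_le {lam : ℕ × ℕ → ℝ} {c σ : ℝ} {ρ α : ℕ} (hc : 0 < c) (hσ : 0 ≤ σ)
    (h : ∀ i, c * pairSize i ^ ρ ≤ lam i) (hs : (α : ℝ) + 2 < ρ * σ) :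
    DirichletSummable lam (multN α) σ := by
  set τ : ℝ := (ρ * σ - α) / 2 with hτ
  have hτ1 : 1 < τ := by rw [hτ]; linarith
  have hsum : Summable fun n : ℕ => ((n : ℝ) + 1) ^ (-τ) := by
    have := (summable_nat_add_iff 1).2 (Real.summable_nat_rpow.2 (by linarith : -τ < -1))
    simpa using this
  have hprod : Summable fun i : ℕ × ℕ => ((i.1 : ℝ) + 1) ^ (-τ) * ((i.2 : ℝ) + 1) ^ (-τ) :=
    hsum.mul_of_nonneg hsum (fun n => by positivity) (fun n => by positivity)
  refine Summable.of_nonneg_of_le (fun i => ?_) (fun i => ?_) (hprod.mul_left (c ^ (-σ)))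
  · have := pairSize_pos i
    have : 0 ≤ lam i := le_trans (by positivity) (h i)
    positivity
  · have hu := pairSize_pos i
    have h1 : (0 : ℝ) < (i.1 : ℝ) + 1 := by positivity
    have h2 : (0 : ℝ) < (i.2 : ℝ) + 1 := by positivity
    have hi : 0 < lam i := lt_of_lt_of_le (by positivity) (h i)
    have hl : lam i ^ (-σ) ≤ c ^ (-σ) * pairSize i ^ (-(ρ * σ)) := by
      calc lam i ^ (-σ) ≤ (c * pairSize i ^ ρ) ^ (-σ) :=
            Real.rpow_le_rpow_of_nonpos (by positivity) (h i) (by linarith)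
        _ = _ := by
            rw [Real.mul_rpow hc.le (by positivity), ← Real.rpow_natCast,
              ← Real.rpow_mul hu.le]
            ring_nf
    have hm : (multN α i : ℝ) ≤ pairSize i ^ (α : ℝ) := by
      rw [multN, Real.rpow_natCast]
      push_cast
      gcongr
      unfold pairSize
      linarith
    calc (multN α i : ℝ) * lam i ^ (-σ)
        ≤ pairSize i ^ (α : ℝ) * (c ^ (-σ) * pairSize i ^ (-(ρ * σ))) := by gcongr
      _ = c ^ (-σ) * (pairSize i ^ (-τ) * pairSize i ^ (-τ)) := by
          rw [mul_left_comm, ← Real.rpow_add hu, ← Real.rpow_add hu]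
          congr 2
          rw [hτ]; ring
      _ ≤ _ := by
          gcongr ?_ * (?_ * ?_)
          · exact Real.rpow_le_rpow_of_nonpos h1 (by unfold pairSize; linarith) (by linarith)
          · exact Real.rpow_le_rpow_of_nonpos h2 (by unfold pairSize; linarith) (by linarith)

/-- For fixed n, the n terms with m ≤ n are each at least a constant times n^(-2), because m + n ≤
2n there. The inner sums thus dominate the harmonic series. -/
lemma not_summable_of_le_pairSize {lam : ℕ × ℕ → ℝ} {C σ : ℝ} {ρ α : ℕ} (hC : 0 < C) (hσ : 0 ≤ σ)
    (hpos : ∀ i, 0 < lam i) (h : ∀ i, lam i ≤ C * pairSize i ^ ρ) (hs : ρ * σ ≤ (α : ℝ) + 2) :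
    ¬ DirichletSummable lam (multN α) σ := by
  intro hsum
  -- The swap makes the index carrying the multiplicity the outer one.
  have hsum' : Summable fun i : ℕ × ℕ => (multN α i.swap : ℝ) * lam i.swap ^ (-σ) :=
    (Equiv.prodComm ℕ ℕ).summable_iff.2 hsum
  have hinner := hsum'.prod
  set b : ℝ := C ^ (-σ) * (2 : ℝ) ^ (-((α : ℝ) + 2)) with hb
  have hb0 : 0 < b := by positivity
  have key : ∀ n : ℕ, b * (1 / ((n : ℝ) + 1)) ≤
      ∑' m : ℕ, (multN α (n, m).swap : ℝ) * lam (n, m).swap ^ (-σ) := by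
    intro n
    have hn : (0 : ℝ) < (n : ℝ) + 1 := by positivity
    have hle := (hsum'.prod_factor n).sum_le_tsum (Finset.range (n + 1))
      (fun m _ => mul_nonneg (Nat.cast_nonneg _) (Real.rpow_nonneg (hpos _).le _))
    refine le_trans ?_ hle
    have hterm : ∀ m ∈ Finset.range (n + 1), b * ((n : ℝ) + 1) ^ (-2 : ℝ) ≤
        (multN α (n, m).swap : ℝ) * lam (n, m).swap ^ (-σ) := by
      intro m hm
      have hmn : (m : ℝ) ≤ n := by exact_mod_cast Finset.mem_range_succ_iff.1 hm
      have hu := pairSize_pos (m, n)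
      have hu1 : 1 ≤ pairSize (m, n) := by linarith [two_le_pairSize (m, n)]
      have hl : C ^ (-σ) * pairSize (m, n) ^ (-((α : ℝ) + 2)) ≤ lam (m, n) ^ (-σ) := by
        calc C ^ (-σ) * pairSize (m, n) ^ (-((α : ℝ) + 2))
            ≤ C ^ (-σ) * pairSize (m, n) ^ (-(ρ * σ)) := by
              gcongr
          _ = (C * pairSize (m, n) ^ ρ) ^ (-σ) := by
              rw [Real.mul_rpow hC.le (by positivity), ← Real.rpow_natCast,
                ← Real.rpow_mul hu.le]
              ring_nf
          _ ≤ _ := Real.rpow_le_rpow_of_nonpos (hpos _) (h _) (by linarith)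
      have hv : (2 * ((n : ℝ) + 1)) ^ (-((α : ℝ) + 2)) ≤ pairSize (m, n) ^ (-((α : ℝ) + 2)) := by
        refine Real.rpow_le_rpow_of_nonpos hu ?_ (by linarith [Nat.cast_nonneg (α := ℝ) α])
        simp only [pairSize]; linarith
      calc b * ((n : ℝ) + 1) ^ (-2 : ℝ)
          = ((n : ℝ) + 1) ^ (α : ℝ) * (C ^ (-σ) * (2 * ((n : ℝ) + 1)) ^ (-((α : ℝ) + 2))) := by
            rw [Real.mul_rpow (by norm_num) hn.le, hb]
            have : ((n : ℝ) + 1) ^ (-2 : ℝ) =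
                ((n : ℝ) + 1) ^ (α : ℝ) * ((n : ℝ) + 1) ^ (-((α : ℝ) + 2)) := by
              rw [← Real.rpow_add hn]; ring_nf
            rw [this]; ring
        _ ≤ ((n : ℝ) + 1) ^ (α : ℝ) * lam (m, n) ^ (-σ) := by
            gcongr
            exact le_trans (by gcongr) hl
        _ = _ := by simp [multN]
    calc b * (1 / ((n : ℝ) + 1))
        = ∑ m ∈ Finset.range (n + 1), b * ((n : ℝ) + 1) ^ (-2 : ℝ) := by
          rw [Finset.sum_const, Finset.card_range, nsmul_eq_mul, Real.rpow_neg hn.le,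
            Real.rpow_two]
          push_cast
          field_simp
      _ ≤ _ := Finset.sum_le_sum hterm
  have hharm : Summable fun n : ℕ => b * (1 / ((n : ℝ) + 1)) :=
    Summable.of_nonneg_of_le (fun n => by positivity) key hinner
  have := (summable_mul_left_iff hb0.ne').1 hharm
  exact Real.not_summable_one_div_natCast
    ((summable_nat_add_iff 1).1 (by simpa using this))

lemma dirichletSummable_iff_of_pairSize {lam : ℕ × ℕ → ℝ} {c C σ : ℝ} {ρ α : ℕ} (hc : 0 < c)
    (hC : 0 < C) (hσ : 0 ≤ σ) (hl : ∀ i, c * pairSize i ^ ρ ≤ lam i)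
    (hu : ∀ i, lam i ≤ C * pairSize i ^ ρ) :
    DirichletSummable lam (multN α) σ ↔ (α : ℝ) + 2 < ρ * σ := by
  refine ⟨fun h => ?_, summable_of_pairSize_le hc hσ hl⟩
  by_contra! hs
  exact not_summable_of_le_pairSize hC hσ
    (fun i => lt_of_lt_of_le (by have := pairSize_pos i; positivity) (hl i)) hu hs h

lemma summable_div_pow_iff {ι : Type*} {lam : ι → ℝ} {mult : ι → ℕ} (hpos : ∀ i, 0 < lam i)
    (q : ℕ) : (Summable fun i => (mult i : ℝ) / lam i ^ (q + 1)) ↔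
      DirichletSummable lam mult ((q : ℝ) + 1) := by
  refine summable_congr fun i => ?_
  rw [Real.rpow_neg (hpos i).le, div_eq_mul_inv]
  congr 2
  rw [← Real.rpow_natCast]
  push_cast
  rfl

lemma genus_eq_of_pairSize {lam : ℕ × ℕ → ℝ} {c C : ℝ} {ρ α g : ℕ} (hc : 0 < c) (hC : 0 < C)
    (hl : ∀ i, c * pairSize i ^ ρ ≤ lam i) (hu : ∀ i, lam i ≤ C * pairSize i ^ ρ)
    (hg : ∀ q : ℕ, α + 2 < ρ * (q + 1) ↔ g ≤ q) :
    genus lam (multN α) = g := by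
  have hpos : ∀ i, 0 < lam i := fun i =>
    lt_of_lt_of_le (by have := pairSize_pos i; positivity) (hl i)
  have : {q : ℕ | Summable fun i => (multN α i : ℝ) / lam i ^ (q + 1)} = Set.Ici g := by
    ext q
    rw [Set.mem_ofPred_eq, summable_div_pow_iff hpos,
      dirichletSummable_iff_of_pairSize hc hC (by positivity) hl hu, Set.mem_Ici, ← hg]
    norm_cast
  rw [genus, this, csInf_Ici]

/-! ### Size, genus and exponent of L and S_p. -/

variable {a x p : ℝ}

lemma exists_bounds_seqL (ha : 0 < a) (hx : 0 < a + 1 + x) :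
    ∃ c C : ℝ, 0 < c ∧ 0 < C ∧ (∀ i, c * pairSize i ^ 1 ≤ seqL a x i) ∧
      ∀ i, seqL a x i ≤ C * pairSize i ^ 1 := by
  refine ⟨min (min a 1) ((a + 1 + x) / 2), a + 1 + |x|, by positivity, by positivity,
    fun i => ?_, fun i => ?_⟩
  · set c := min (min a 1) ((a + 1 + x) / 2)
    have h1 : c ≤ a := (min_le_left _ _).trans (min_le_left _ _)
    have h2 : c ≤ 1 := (min_le_left _ _).trans (min_le_right _ _)
    have h3 : c ≤ (a + 1 + x) / 2 := min_le_right _ _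
    have := mul_le_mul_of_nonneg_right h1 (Nat.cast_nonneg (α := ℝ) i.1)
    have := mul_le_mul_of_nonneg_right h2 (Nat.cast_nonneg (α := ℝ) i.2)
    simp only [pairSize, seqL, pow_one]
    linarith
  · have h1 := Nat.cast_nonneg (α := ℝ) i.1
    have h2 := Nat.cast_nonneg (α := ℝ) i.2
    simp only [pairSize, seqL, pow_one]
    have := le_abs_self x
    have := abs_nonneg x
    have := mul_nonneg ha.le h2
    have := mul_nonneg (abs_nonneg x) h1
    have := mul_nonneg (abs_nonneg x) h2
    nlinarith

lemma seqL_ge (ha : 0 < a) (i : ℕ × ℕ) : a + 1 + x ≤ seqL a x i := by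
  have h1 := Nat.cast_nonneg (α := ℝ) i.1
  have h2 := Nat.cast_nonneg (α := ℝ) i.2
  have := mul_nonneg ha.le h1
  simp only [seqL]
  linarith

lemma seqS_eq (i : ℕ × ℕ) : seqS a x p i = seqL a x i ^ 2 + p := rfl

lemma seqS_ge (ha : 0 < a) (hx : 0 < a + 1 + x) (i : ℕ × ℕ) :
    (a + 1 + x) ^ 2 + p ≤ seqS a x p i := by
  rw [seqS_eq]
  have := seqL_ge (x := x) ha i
  gcongr

lemma exists_bounds_seqS (ha : 0 < a) (hx : 0 < a + 1 + x) (hp : 0 < (a + 1 + x) ^ 2 + p) :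
    ∃ c C : ℝ, 0 < c ∧ 0 < C ∧ (∀ i, c * pairSize i ^ 2 ≤ seqS a x p i) ∧
      ∀ i, seqS a x p i ≤ C * pairSize i ^ 2 := by
  obtain ⟨c, C, hc, hC, hl, hu⟩ := exists_bounds_seqL ha hx
  set y := a + 1 + x
  obtain ⟨κ, hκ, hκ'⟩ : ∃ κ : ℝ, 0 < κ ∧ ∀ i, κ * seqL a x i ^ 2 ≤ seqS a x p i := by
    rcases le_total 0 p with h | h
    · exact ⟨1, one_pos, fun i => by rw [seqS_eq]; linarith⟩
    -- For p ≤ 0 the ratio (λ² + p)/λ² = 1 + p/λ² is smallest at the least element λ = y, where it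
    -- equals this constant.
    · refine ⟨(y ^ 2 + p) / y ^ 2, by positivity, fun i => ?_⟩
      have hy : y ^ 2 ≤ seqL a x i ^ 2 := by
        have := seqL_ge (x := x) ha i
        gcongr
      have : (-p) * y ^ 2 ≤ (-p) * seqL a x i ^ 2 := by
        apply mul_le_mul_of_nonneg_left hy; linarith
      rw [seqS_eq, div_mul_eq_mul_div, div_le_iff₀ (by positivity)]
      linarith
  refine ⟨κ * c ^ 2, C ^ 2 + |p|, by positivity, by positivity, fun i => ?_, fun i => ?_⟩
  · refine le_trans ?_ (hκ' i)
    have h0 := pairSize_pos i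
    have := hl i
    rw [pow_one] at this
    rw [mul_assoc, ← mul_pow]
    gcongr
  · have h0 := two_le_pairSize i
    have := hu i
    rw [pow_one] at this
    have hL : 0 ≤ seqL a x i := hx.le.trans (seqL_ge ha i)
    have h1 : seqL a x i ^ 2 ≤ (C * pairSize i) ^ 2 := by gcongr
    have h2 : |p| * 1 ≤ |p| * pairSize i ^ 2 := by
      gcongr
      nlinarith
    have := le_abs_self p
    rw [seqS_eq, add_mul, ← mul_pow]
    linarith

lemma genus_seqL (α : ℕ) (ha : 0 < a) (hx : 0 < a + 1 + x) :
    genus (seqL a x) (multN α) = α + 2 := by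
  obtain ⟨c, C, hc, hC, hl, hu⟩ := exists_bounds_seqL ha hx
  exact genus_eq_of_pairSize hc hC hl hu fun q => by omega

lemma genus_seqS (α : ℕ) (ha : 0 < a) (hx : 0 < a + 1 + x) (hp : 0 < (a + 1 + x) ^ 2 + p) :
    genus (seqS a x p) (multN α) = α / 2 + 1 := by
  obtain ⟨c, C, hc, hC, hl, hu⟩ := exists_bounds_seqS ha hx hp
  exact genus_eq_of_pairSize hc hC hl hu fun q => by omega

lemma le_exponent_seqS (α : ℕ) (ha : 0 < a) (hx : 0 < a + 1 + x)
    (hp : 0 < (a + 1 + x) ^ 2 + p) :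
    ((α : ℝ) + 2) / 2 ≤ exponent (seqS a x p) (multN α) := by
  obtain ⟨c, C, hc, hC, hl, hu⟩ := exists_bounds_seqS ha hx hp
  refine le_csInf ⟨(α : ℝ) + 3, by positivity, ?_⟩ ?_
  · rw [dirichletSummable_iff_of_pairSize hc hC (by positivity) hl hu]
    push_cast
    linarith [Nat.cast_nonneg (α := ℝ) α]
  · rintro σ ⟨hσ, h⟩
    rw [dirichletSummable_iff_of_pairSize hc hC hσ hl hu] at h
    push_cast at h
    linarith

/-! ### Fredholm determinants and the product formula. -/

lemma sum_Icc_eq_neg_logTaylor (n : ℕ) (w : ℂ) :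
    ∑ j ∈ Finset.Icc 1 n, ((-1 : ℂ) ^ j / (j : ℂ)) * w ^ j = -Complex.logTaylor (n + 1) w := by
  induction n with
  | zero => simp [Complex.logTaylor]
  | succ n ih =>
    rw [Finset.sum_Icc_succ_top (by omega), ih, Complex.logTaylor_succ (n + 1), Pi.add_apply]
    ring

/-- The products defining the Fredholm determinant converge unconditionally. -/
lemma multipliable_fredholmFactor {ι : Type*} {lam : ι → ℝ} {mult : ι → ℕ}
    (hpos : ∀ i, 0 < lam i) (hlim : Tendsto lam cofinite atTop)
    (hsum : ∃ q : ℕ, Summable fun i => (mult i : ℝ) / lam i ^ (q + 1)) (z : ℂ) :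
    Multipliable (fredholmFactor lam mult z) := by
  set q := genus lam mult with hq
  have hs : Summable fun i => (mult i : ℝ) / lam i ^ (q + 1) := Nat.sInf_mem hsum
  set B : ι → ℝ := fun i => 2 * ‖z‖ ^ (q + 1) * ((mult i : ℝ) / lam i ^ (q + 1)) with hB
  have hBs : Summable B := hs.mul_left _
  have hsummable : Summable fun i => fredholmFactor lam mult z i - 1 := by
    refine (hBs.mul_left 2).of_norm_bounded_eventually ?_
    filter_upwards [hlim.eventually_ge_atTop (2 * ‖z‖ + 1),
      hBs.tendsto_cofinite_zero.eventually_le_const one_pos] with i hi hBi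
    have hli := hpos i
    set w : ℂ := z / (lam i : ℂ) with hw
    have hwn : ‖w‖ = ‖z‖ / lam i := by
      rw [hw, norm_div, Complex.norm_real, Real.norm_of_nonneg hli.le]
    have hw2 : ‖w‖ ≤ 1 / 2 := by
      rw [hwn, div_le_iff₀ hli]; linarith
    have hw1 : ‖w‖ < 1 := by linarith
    have hne : 1 + w ≠ 0 := Complex.slitPlane_ne_zero (Complex.mem_slitPlane_of_norm_lt_one hw1)
    -- For all but finitely many indices the factor is exp(mult · u), where u is the Taylor
    -- remainder of log(1 + w), of size O(|w|^(q + 1)). The genus makes these summable.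
    set u : ℂ := Complex.log (1 + w) - Complex.logTaylor (q + 1) w with hu
    have hfac : fredholmFactor lam mult z i = Complex.exp (mult i * u) := by
      rw [fredholmFactor, ← hq, Complex.exp_nat_mul, hu, sub_eq_add_neg, Complex.exp_add,
        Complex.exp_log hne, ← sum_Icc_eq_neg_logTaylor, hw]
      simp only [div_pow]
    have hub : ‖u‖ ≤ 2 * ‖w‖ ^ (q + 1) := by
      refine (Complex.norm_log_sub_logTaylor_le q hw1).trans ?_
      have h2 : (1 - ‖w‖)⁻¹ ≤ 2 := by
        rw [inv_le_comm₀ (by linarith) two_pos]; linarith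
      refine (div_le_self (by have : 0 < 1 - ‖w‖ := by linarith
                              positivity) (by linarith [Nat.cast_nonneg (α := ℝ) q])).trans ?_
      rw [mul_comm]
      gcongr
    have hmu : ‖(mult i : ℂ) * u‖ ≤ B i := by
      rw [norm_mul, Complex.norm_natCast]
      calc (mult i : ℝ) * ‖u‖ ≤ mult i * (2 * ‖w‖ ^ (q + 1)) := by gcongr
        _ = B i := by rw [hB, hwn, div_pow]; ring
    rw [hfac]
    exact (Complex.norm_exp_sub_one_le (hmu.trans hBi)).trans (by gcongr)
  simpa using Complex.multipliable_one_add_of_summable hsummable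

lemma sum_Icc_of_odd_eq_zero {M : Type*} [AddCommMonoid M] (f : ℕ → M)
    (hf : ∀ j, Odd j → f j = 0) (n : ℕ) :
    ∑ j ∈ Finset.Icc 1 n, f j = ∑ k ∈ Finset.Icc 1 (n / 2), f (2 * k) := by
  induction n with
  | zero => simp
  | succ n ih =>
    rw [Finset.sum_Icc_succ_top (by omega), ih]
    rcases Nat.even_or_odd (n + 1) with h | h
    · have h1 : (n + 1) / 2 = n / 2 + 1 := by obtain ⟨k, hk⟩ := h; omega
      have h2 : 2 * (n / 2 + 1) = n + 1 := by obtain ⟨k, hk⟩ := h; omega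
      rw [h1, Finset.sum_Icc_succ_top (by omega), h2]
    · have h1 : (n + 1) / 2 = n / 2 := by obtain ⟨k, hk⟩ := h; omega
      rw [h1, hf _ h, add_zero]

/-- (1 + iw)(1 - iw) = 1 + w², and in the summed exponents only even j = 2k survive, each giving
2(-1)^k w^(2k)/(2k). The range j ≤ q becomes k ≤ q/2, which is where the halved genus is needed. -/
lemma fredholmFactor_mul_eq_sq {ι : Type*} {lam lam' : ι → ℝ} {mult : ι → ℕ}
    (hsq : ∀ i, lam' i = lam i ^ 2) (hg : genus lam' mult = genus lam mult / 2)
    (z : ℂ) (i : ι) :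
    fredholmFactor lam mult (Complex.I * z) i * fredholmFactor lam mult (-Complex.I * z) i =
      fredholmFactor lam' mult (z ^ 2) i := by
  have hI : ∀ k : ℕ, Complex.I ^ (2 * k) = (-1) ^ k := fun k => by
    rw [pow_mul, Complex.I_sq]
  simp only [fredholmFactor, hsq, hg]
  rw [← mul_pow, mul_mul_mul_comm, ← Complex.exp_add, ← Finset.sum_add_distrib]
  congr 2
  · push_cast
    linear_combination (-(z ^ 2) / (lam i : ℂ) ^ 2) * Complex.I_sq
  · rw [sum_Icc_of_odd_eq_zero]
    · congr 1
      refine Finset.sum_congr rfl fun k hk => ?_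
      have hk0 : (k : ℂ) ≠ 0 := by
        have := (Finset.mem_Icc.1 hk).1
        exact_mod_cast (by omega : k ≠ 0)
      rw [mul_pow, mul_pow, (even_two_mul k).neg_pow Complex.I, hI, (even_two_mul k).neg_one_pow]
      push_cast
      rw [← pow_mul, ← pow_mul]
      field_simp
      ring
    · intro j hj
      rw [mul_pow, mul_pow, hj.neg_pow Complex.I]
      ring

lemma exists_summable_div_pow_of_pairSize_le {lam : ℕ × ℕ → ℝ} {c : ℝ} {ρ : ℕ} (α : ℕ)
    (hc : 0 < c) (hρ : ρ ≠ 0) (h : ∀ i, c * pairSize i ^ ρ ≤ lam i) :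
    ∃ q : ℕ, Summable fun i => (multN α i : ℝ) / lam i ^ (q + 1) := by
  have hpos : ∀ i, 0 < lam i := fun i =>
    lt_of_lt_of_le (by have := pairSize_pos i; positivity) (h i)
  refine ⟨α + 2, (summable_div_pow_iff hpos _).2
    (summable_of_pairSize_le hc (by positivity) h ?_)⟩
  have h1 : (1 : ℝ) ≤ ρ := by exact_mod_cast Nat.one_le_iff_ne_zero.2 hρ
  push_cast
  nlinarith [Nat.cast_nonneg (α := ℝ) α]

lemma multipliable_fredholmFactor_of_pairSize_le {lam : ℕ × ℕ → ℝ} {c : ℝ} {ρ : ℕ} (α : ℕ)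
    (hc : 0 < c) (hρ : ρ ≠ 0) (h : ∀ i, c * pairSize i ^ ρ ≤ lam i) (z : ℂ) :
    Multipliable (fredholmFactor lam (multN α) z) :=
  multipliable_fredholmFactor
    (fun i => lt_of_lt_of_le (by have := pairSize_pos i; positivity) (h i))
    (tendsto_of_pairSize_le hc hρ h) (exists_summable_div_pow_of_pairSize_le α hc hρ h) z

lemma multipliable_fredholmFactor_seqL (α : ℕ) (ha : 0 < a) (hx : 0 < a + 1 + x) (z : ℂ) :
    Multipliable (fredholmFactor (seqL a x) (multN α) z) := by
  obtain ⟨c, C, hc, hC, hl, hu⟩ := exists_bounds_seqL ha hx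
  exact multipliable_fredholmFactor_of_pairSize_le α hc one_ne_zero hl z

lemma multipliable_fredholmFactor_seqS (α : ℕ) (ha : 0 < a) (hx : 0 < a + 1 + x) {p : ℝ}
    (hp : 0 < (a + 1 + x) ^ 2 + p) (z : ℂ) :
    Multipliable (fredholmFactor (seqS a x p) (multN α) z) := by
  obtain ⟨c, C, hc, hC, hl, hu⟩ := exists_bounds_seqS ha hx hp
  exact multipliable_fredholmFactor_of_pairSize_le α hc two_ne_zero hl z

lemma fredholm_seqL_mul (α : ℕ) (ha : 0 < a) (hx : 0 < a + 1 + x) (z : ℂ) :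
    fredholm (seqL a x) (multN α) (Complex.I * z) *
        fredholm (seqL a x) (multN α) (-Complex.I * z) =
      fredholm (seqS a x 0) (multN α) (z ^ 2) := by
  rw [fredholm, fredholm, fredholm, ← (multipliable_fredholmFactor_seqL α ha hx _).tprod_mul
    (multipliable_fredholmFactor_seqL α ha hx _)]
  refine tprod_congr fun i => fredholmFactor_mul_eq_sq (fun i => by rw [seqS_eq, add_zero]) ?_ z i
  rw [genus_seqL α ha hx, genus_seqS α ha hx (by positivity)]
  omega

/-! ### The Laplace transform of L and its Taylor expansion. -/

open Polynomial in
/-- The weighted geometric series `∑ (n + 1) ^ α * choose (n + k) k * r ^ n` is a polynomial in `r`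
divided by `(1 - r) ^ (α + k + 1)`. -/
lemma exists_hasSum_pow_mul_choose_mul_geometric (α k : ℕ) :
    ∃ P : ℂ[X], ∀ r : ℂ, ‖r‖ < 1 →
      HasSum (fun n : ℕ => ((n : ℂ) + 1) ^ α * ((n + k).choose k : ℂ) * r ^ n)
        (P.eval r / (1 - r) ^ (α + k + 1)) := by
  induction α generalizing k with
  | zero =>
    refine ⟨1, fun r hr => ?_⟩
    simpa using hasSum_choose_mul_geometric_of_norm_lt_one k hr
  | succ α ih =>
    obtain ⟨P, hP⟩ := ih k
    obtain ⟨Q, hQ⟩ := ih (k + 1)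
    -- The recursion comes from (n + 1) C(n+k, k) = (k + 1) C(n+k+1, k+1) - k C(n+k, k); it raises
    -- k, hence the induction for all k.
    refine ⟨C ((k : ℂ) + 1) * Q - C (k : ℂ) * (P * (1 - X)), fun r hr => ?_⟩
    have h1r : 1 - r ≠ 0 := by
      intro h
      rw [← sub_eq_zero.1 h] at hr
      simp at hr
    convert! ((hQ r hr).mul_left ((k : ℂ) + 1)).sub ((hP r hr).mul_left (k : ℂ)) using 1
    · funext n
      have h : ((n + k + 1 : ℕ) : ℂ) * ((n + k).choose k : ℂ) =
          ((n + (k + 1)).choose (k + 1) : ℂ) * ((k + 1 : ℕ) : ℂ) := by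
        exact_mod_cast Nat.add_one_mul_choose_eq (n + k) k
      push_cast at h
      linear_combination (((n : ℂ) + 1) ^ α * r ^ n) * h
    · simp only [eval_sub, eval_mul, eval_C, eval_one, eval_X]
      rw [show α + (k + 1) + 1 = α + k + 1 + 1 by ring, show α + 1 + k + 1 = α + k + 1 + 1 by ring,
        pow_succ (1 - r) (α + k + 1)]
      field_simp

lemma exists_analyticAt_one_sub_exp {a : ℂ} (ha : a ≠ 0) :
    ∃ u : ℂ → ℂ, AnalyticAt ℂ u 0 ∧ u 0 ≠ 0 ∧ ∀ w, 1 - Complex.exp (-a * w) = w * u w := by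
  set f : ℂ → ℂ := fun w => 1 - Complex.exp (-a * w) with hf
  have hfa : AnalyticAt ℂ f 0 := by fun_prop
  obtain ⟨q, hq⟩ := hfa
  refine ⟨dslope f 0, ⟨_, hq.has_fpower_series_dslope_fslope⟩, ?_, fun w => ?_⟩
  · have : HasDerivAt f a 0 := by
      have h := ((hasDerivAt_id (0 : ℂ)).const_mul (-a)).cexp.const_sub 1
      simpa [hf] using! h
    rw [dslope_same, this.deriv]
    exact ha
  · have := sub_smul_dslope f 0 w
    simp only [sub_zero, smul_eq_mul] at this
    rw [this]
    simp [hf]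

lemma norm_exp_neg_mul_lt_one {b : ℝ} (hb : 0 < b) {w : ℂ} (hw : 0 < w.re) :
    ‖Complex.exp (-(b : ℂ) * w)‖ < 1 := by
  rw [Complex.norm_exp, Real.exp_lt_one_iff]
  simp
  positivity

/-- The Laplace transform `∑ n ^ α * exp (-(a m + n + x) w)` has at `w = 0` a pole of order at most
`α + 2`. -/
lemma exists_hasSum_exp_seqL {a x : ℝ} (α : ℕ) (ha : 0 < a) :
    ∃ h : ℂ → ℂ, AnalyticAt ℂ h 0 ∧ ∀ w : ℂ, 0 < w.re →
      HasSum (fun i => (multN α i : ℂ) * Complex.exp (-(seqL a x i : ℂ) * w))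
        (h w / w ^ (α + 2)) := by
  obtain ⟨P, hP⟩ := exists_hasSum_pow_mul_choose_mul_geometric α 0
  obtain ⟨u, hu, hu0, huw⟩ :=
    exists_analyticAt_one_sub_exp (a := (a : ℂ)) (by exact_mod_cast ha.ne')
  obtain ⟨v, hv, hv0, hvw⟩ := exists_analyticAt_one_sub_exp (a := 1) one_ne_zero
  -- The simple zeros 1 - exp(-aw) = w u(w) and 1 - exp(-w) = w v(w) enter with exponents 1 and α +
  -- 1, which produces w^(α + 2).
  refine ⟨fun w => Complex.exp (-((a + 1 + x : ℝ) : ℂ) * w) * ((u w)⁻¹ *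
    (P.eval (Complex.exp (-1 * w)) / v w ^ (α + 1))), ?_, fun w hw => ?_⟩
  · have hPa : AnalyticAt ℂ (fun w : ℂ => P.eval (Complex.exp (-1 * w))) 0 :=
      (Differentiable.analyticAt (f := fun w : ℂ => P.eval (Complex.exp (-1 * w)))
        (P.differentiable.comp (by fun_prop)) 0)
    exact AnalyticAt.mul (by fun_prop)
      ((hu.inv hu0).mul (hPa.div (hv.pow _) (pow_ne_zero _ hv0)))
  · have hw0 : w ≠ 0 := by rintro rfl; simp at hw
    have ha1 := norm_exp_neg_mul_lt_one ha hw
    have h1 := norm_exp_neg_mul_lt_one one_pos hw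
    rw [Complex.ofReal_one] at h1
    set A : ℂ := Complex.exp (-(a : ℂ) * w) with hAdef
    set B : ℂ := Complex.exp (-1 * w) with hBdef
    have hA : HasSum (fun m : ℕ => A ^ m) (1 - A)⁻¹ := hasSum_geometric_of_norm_lt_one ha1
    have hB : HasSum (fun n : ℕ => ((n : ℂ) + 1) ^ α * B ^ n) (P.eval B / (1 - B) ^ (α + 1)) := by
      simpa using hP B h1
    have hs : Summable fun i : ℕ × ℕ => A ^ i.1 * (((i.2 : ℂ) + 1) ^ α * B ^ i.2) :=
      summable_mul_of_summable_norm (f := fun m : ℕ => A ^ m)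
        (g := fun n : ℕ => ((n : ℂ) + 1) ^ α * B ^ n) hA.summable.norm hB.summable.norm
    have hAB := (hA.mul hB hs).mul_left (Complex.exp (-((a + 1 + x : ℝ) : ℂ) * w))
    convert! hAB using 1
    · funext i
      rw [hAdef, hBdef, ← Complex.exp_nat_mul, ← Complex.exp_nat_mul]
      have hexp : Complex.exp (-(seqL a x i : ℂ) * w) = Complex.exp (-((a + 1 + x : ℝ) : ℂ) * w) *
          (Complex.exp (i.1 * (-(a : ℂ) * w)) * Complex.exp (i.2 * (-1 * w))) := by
        rw [← Complex.exp_add, ← Complex.exp_add]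
        congr 1
        simp only [seqL]
        push_cast
        ring
      rw [hexp, multN]
      push_cast
      ring
    · rw [hAdef, hBdef, huw, hvw, mul_inv, mul_pow]
      have h2 : w ^ (α + 2) = w * w ^ (α + 1) := by ring
      rw [h2]
      simp only [div_eq_mul_inv, mul_inv]
      ring

lemma _root_.AnalyticAt.exists_taylor_bound {h : ℂ → ℂ} (hh : AnalyticAt ℂ h 0) :
    ∃ b : ℕ → ℂ, ∀ N : ℕ, ∃ r > 0, ∃ C ≥ 0, ∀ w, ‖w‖ < r →
      ‖h w - ∑ k ∈ Finset.range N, b k * w ^ k‖ ≤ C * ‖w‖ ^ N := by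
  obtain ⟨q, hq⟩ := hh
  refine ⟨fun k => q.coeff k, fun N => ?_⟩
  obtain ⟨C, hC, hb⟩ := (hq.isBigO_sub_partialSum_pow N).exists_nonneg
  obtain ⟨r, hr, hr'⟩ := Metric.eventually_nhds_iff.1 hb.bound
  refine ⟨r, hr, C, hC, fun w hw => ?_⟩
  have := hr' (y := w) (by simpa using hw)
  simpa [FormalMultilinearSeries.partialSum, FormalMultilinearSeries.apply_eq_pow_smul_coeff,
    mul_comm] using this

/-- Taylor expansion along the rays `ε ↦ ε * v` in the half plane, uniformly in `v`. -/
lemma exists_uniform_taylor_bound {h : ℂ → ℂ} {b : ℕ → ℂ} {d N : ℕ}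
    (hcont : ContinuousAt h 0)
    (hb : ∃ r > 0, ∃ C ≥ 0, ∀ w, ‖w‖ < r →
      ‖h w - ∑ k ∈ Finset.range (N + d), b k * w ^ k‖ ≤ C * ‖w‖ ^ (N + d))
    (hle : ∀ w : ℂ, 0 < w.re → ‖h w / w ^ d‖ ≤ ‖h w.re / (w.re : ℂ) ^ d‖) :
    ∃ C δ : ℝ, 0 ≤ C ∧ 0 < δ ∧ ∀ ε : ℝ, 0 < ε → ε < δ → ∀ v : ℂ, v.re = 2 →
      ‖h (ε * v) - ∑ k ∈ Finset.range (N + d), b k * (ε * v) ^ k‖ ≤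
        C * ε ^ N * ‖v‖ ^ (N + d) := by
  obtain ⟨r, hr, C, hC, hT⟩ := hb
  obtain ⟨δ, hδ, hH⟩ := Metric.continuousAt_iff.1 hcont 1 one_pos
  set H : ℝ := ‖h 0‖ + 1 with hHdef
  have hH' : ∀ w, ‖w‖ < δ → ‖h w‖ ≤ H := by
    intro w hw
    have h1 := hH (x := w) (by simpa using hw)
    rw [dist_eq_norm] at h1
    have := norm_le_norm_add_norm_sub' (h w) (h 0)
    linarith
  set S : ℝ := ∑ k ∈ Finset.range (N + d), ‖b k‖ / r ^ (N + d - k) with hS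
  have hS0 : 0 ≤ S := Finset.sum_nonneg fun k _ => by positivity
  refine ⟨C + H / r ^ N + S, min 1 (δ / 2), by positivity, by positivity,
    fun ε hε hεδ v hv => ?_⟩
  have hε1 : ε ≤ 1 := (hεδ.trans_le (min_le_left _ _)).le
  have hε2 : 2 * ε < δ := by linarith [hεδ.trans_le (min_le_right 1 (δ / 2))]
  have hv2 : 2 ≤ ‖v‖ := by
    have := Complex.re_le_norm v
    linarith
  have hv0 : v ≠ 0 := by rintro rfl; norm_num at hv2
  have hwn : ‖(ε : ℂ) * v‖ = ε * ‖v‖ := by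
    rw [norm_mul, Complex.norm_real, Real.norm_of_nonneg hε.le]
  have hpow : (ε * ‖v‖) ^ (N + d) ≤ ε ^ N * ‖v‖ ^ (N + d) := by
    rw [mul_pow]
    gcongr ?_ * _
    exact pow_le_pow_of_le_one hε.le hε1 (by omega)
  have hX : 0 ≤ ε ^ N * ‖v‖ ^ (N + d) := by positivity
  -- Inside the disc of radius r Taylor's bound applies. Outside it, h and the Taylor polynomial are
  -- estimated separately, and ε‖v‖/r ≥ 1 supplies the missing powers of ε.
  rcases lt_or_ge ‖(ε : ℂ) * v‖ r with hlt | hge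
  · calc _ ≤ C * (ε * ‖v‖) ^ (N + d) := by rw [← hwn]; exact hT _ hlt
      _ ≤ C * (ε ^ N * ‖v‖ ^ (N + d)) := by gcongr
      _ ≤ (C + H / r ^ N + S) * (ε ^ N * ‖v‖ ^ (N + d)) := by
        gcongr
        have : 0 ≤ H / r ^ N := by positivity
        linarith
      _ = _ := by ring
  · rw [hwn] at hge
    have hre : ((ε : ℂ) * v).re = 2 * ε := by simp [hv, mul_comm]
    have hhw : ‖h (ε * v)‖ ≤ H / r ^ N * (ε ^ N * ‖v‖ ^ (N + d)) := by
      -- Comparison with the real point 2ε near 0, where h is bounded; this controls h(εv) however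
      -- large v is.
      have h1 := hle (ε * v) (by rw [hre]; positivity)
      rw [hre, norm_div, norm_div, norm_pow, norm_pow, hwn, Complex.norm_real,
        Real.norm_of_nonneg (by positivity), div_le_iff₀ (by positivity)] at h1
      have h2 : ‖h ((2 * ε : ℝ) : ℂ)‖ ≤ H := by
        apply hH'
        rw [Complex.norm_real, Real.norm_of_nonneg (by positivity)]
        exact hε2
      have h3 : 1 ≤ (ε * ‖v‖ / r) ^ N := one_le_pow₀ ((one_le_div hr).2 hge)
      calc ‖h (ε * v)‖ ≤ _ := h1
        _ = ‖h ((2 * ε : ℝ) : ℂ)‖ * ((1 / 2) ^ d * ‖v‖ ^ d) := by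
          rw [mul_pow, mul_pow, one_div, inv_pow]; field_simp
        _ ≤ H * (1 * ‖v‖ ^ d) := by
          gcongr
          exact pow_le_one₀ (by norm_num) (by norm_num)
        _ ≤ H * (1 * ‖v‖ ^ d) * (ε * ‖v‖ / r) ^ N := le_mul_of_one_le_right (by positivity) h3
        _ = _ := by rw [div_pow, mul_pow, pow_add]; ring
    have hsum : ‖∑ k ∈ Finset.range (N + d), b k * (ε * v) ^ k‖ ≤
        S * (ε ^ N * ‖v‖ ^ (N + d)) := by
      refine (norm_sum_le _ _).trans ?_
      rw [hS, Finset.sum_mul]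
      refine Finset.sum_le_sum fun k hk => ?_
      have hk' : k ≤ N + d := (Finset.mem_range.1 hk).le
      rw [norm_mul, norm_pow, hwn, div_mul_eq_mul_div, le_div_iff₀ (by positivity), mul_assoc]
      refine mul_le_mul_of_nonneg_left ?_ (norm_nonneg _)
      calc (ε * ‖v‖) ^ k * r ^ (N + d - k) ≤ (ε * ‖v‖) ^ k * (ε * ‖v‖) ^ (N + d - k) := by gcongr
        _ = (ε * ‖v‖) ^ (N + d) := by rw [← pow_add]; congr 1; omega
        _ ≤ _ := hpow
    calc _ ≤ _ := norm_sub_le _ _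
      _ ≤ H / r ^ N * (ε ^ N * ‖v‖ ^ (N + d)) + S * (ε ^ N * ‖v‖ ^ (N + d)) := add_le_add hhw hsum
      _ ≤ C * (ε ^ N * ‖v‖ ^ (N + d)) + H / r ^ N * (ε ^ N * ‖v‖ ^ (N + d)) +
          S * (ε ^ N * ‖v‖ ^ (N + d)) := by
        have : 0 ≤ C * (ε ^ N * ‖v‖ ^ (N + d)) := by positivity
        linarith
      _ = _ := by ring

open MeasureTheory

/-! ### From the Laplace transform to Gaussian sums. -/

/-- `F` has the asymptotic expansion `∑ c k * ε ^ k` for `ε → 0⁺`. -/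
def HasPowerExpansion (F : ℝ → ℝ) (c : ℕ → ℝ) : Prop :=
  ∀ N : ℕ, (fun ε : ℝ => F ε - ∑ k ∈ Finset.range N, c k * ε ^ k) =O[𝓝[>] (0 : ℝ)]
    fun ε : ℝ => ε ^ N

lemma isBigO_pow_pow_nhdsGT {m n : ℕ} (h : m ≤ n) :
    (fun ε : ℝ => ε ^ n) =O[𝓝[>] (0 : ℝ)] fun ε : ℝ => ε ^ m :=
  Asymptotics.IsBigO.of_bound 1 (by
    filter_upwards [Ioo_mem_nhdsGT (one_pos : (0 : ℝ) < 1)] with ε hε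
    rw [norm_pow, norm_pow, one_mul, Real.norm_of_nonneg hε.1.le]
    exact pow_le_pow_of_le_one hε.1.le hε.2.le h)

/-- Terms of index at least N are themselves O(ε^N), so a longer truncation may be used to reach a
given order. -/
lemma hasPowerExpansion_of_exists_ge {F : ℝ → ℝ} {c : ℕ → ℝ}
    (h : ∀ N : ℕ, ∃ M ≥ N, (fun ε : ℝ => F ε - ∑ k ∈ Finset.range M, c k * ε ^ k)
      =O[𝓝[>] (0 : ℝ)] fun ε : ℝ => ε ^ N) : HasPowerExpansion F c := by
  intro N
  obtain ⟨M, hM, hO⟩ := h N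
  have htail : (fun ε : ℝ => ∑ k ∈ Finset.Ico N M, c k * ε ^ k) =O[𝓝[>] (0 : ℝ)]
      fun ε : ℝ => ε ^ N :=
    Asymptotics.IsBigO.fun_sum fun k hk =>
      (isBigO_pow_pow_nhdsGT (Finset.mem_Ico.1 hk).1).const_mul_left _
  refine (hO.add htail).congr_left fun ε => ?_
  rw [← Finset.sum_range_add_sum_Ico _ hM]
  ring

/-- The vertical line `Re = 2`. -/
noncomputable def lineTwo (ξ : ℝ) : ℂ := 2 * (1 + ξ * Complex.I)

lemma lineTwo_re (ξ : ℝ) : (lineTwo ξ).re = 2 := by simp [lineTwo]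

lemma lineTwo_ne_zero (ξ : ℝ) : lineTwo ξ ≠ 0 := fun h => by
  have := lineTwo_re ξ
  rw [h] at this
  norm_num at this

lemma continuous_lineTwo : Continuous lineTwo := by unfold lineTwo; fun_prop

/-- The weight of the representation of the Gaussian as a superposition of exponentials. -/
noncomputable def lineWeight (ξ : ℝ) : ℂ := Complex.exp ((1 + ξ * Complex.I) ^ 2)

lemma continuous_lineWeight : Continuous lineWeight := by unfold lineWeight; fun_prop

lemma norm_lineWeight (ξ : ℝ) : ‖lineWeight ξ‖ = Real.exp (1 - ξ ^ 2) := by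
  rw [lineWeight, Complex.norm_exp]
  congr 1
  simp [pow_two]

lemma integrable_norm_lineTwo_pow_mul_exp (k : ℕ) :
    Integrable fun ξ : ℝ => ‖lineTwo ξ‖ ^ k * Real.exp (1 - ξ ^ 2) := by
  refine ((integrable_exp_neg_mul_sq (b := 1 / 2) (by norm_num)).const_mul
    (2 ^ k * Real.exp (1 + (k : ℝ) ^ 2 / 2))).mono'
    (((continuous_lineTwo.norm.pow k).mul (by fun_prop)).aestronglyMeasurable)
    (Eventually.of_forall fun ξ => ?_)
  rw [Real.norm_of_nonneg (by positivity)]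
  have h1 : ‖lineTwo ξ‖ ≤ 2 * Real.exp |ξ| := by
    rw [lineTwo, norm_mul]
    have : ‖(1 : ℂ) + ξ * Complex.I‖ ≤ 1 + |ξ| := by
      refine (norm_add_le _ _).trans ?_
      simp
    have h2 := Real.add_one_le_exp |ξ|
    simp only [Complex.norm_ofNat]
    linarith
  calc ‖lineTwo ξ‖ ^ k * Real.exp (1 - ξ ^ 2)
      ≤ (2 * Real.exp |ξ|) ^ k * Real.exp (1 - ξ ^ 2) := by gcongr
    _ = 2 ^ k * Real.exp (k * |ξ| + (1 - ξ ^ 2)) := by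
        rw [mul_pow, ← Real.exp_nat_mul, mul_assoc, ← Real.exp_add]
    _ ≤ 2 ^ k * Real.exp (1 + (k : ℝ) ^ 2 / 2 + -(1 / 2) * ξ ^ 2) := by
        have h3 := sq_nonneg ((k : ℝ) - |ξ|)
        rw [sub_sq, sq_abs] at h3
        refine mul_le_mul_of_nonneg_left (Real.exp_le_exp.2 ?_) (by positivity)
        linarith
    _ = _ := by rw [Real.exp_add]; ring

/-- Completing the square: -2y(1 + iξ) + (1 + iξ)² = (1 + iξ - y)² - y². -/
lemma integral_exp_lineTwo_mul_lineWeight (y : ℝ) :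
    ∫ ξ : ℝ, Complex.exp (-y * lineTwo ξ) * lineWeight ξ =
      (Real.pi : ℂ) ^ (1 / 2 : ℂ) * Complex.exp (-(y : ℂ) ^ 2) := by
  have := integral_cexp_quadratic (b := -1) (by simp) (2 * Complex.I * (1 - y)) (1 - 2 * y)
  rw [neg_neg, div_one] at this
  convert! this using 1
  · congr 1
    funext ξ
    rw [lineWeight, ← Complex.exp_add, lineTwo]
    congr 1
    linear_combination ((ξ : ℂ) ^ 2) * Complex.I_sq
  · congr 2
    linear_combination (-(1 - (y : ℂ)) ^ 2) * Complex.I_sq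

/-- The Gaussian sums `∑ mult i * exp (-(lam i ε) ^ 2)` have an expansion in powers of `ε` when the
Laplace transform `∑ mult i * exp (-(lam i) w)` has a pole at `w = 0`. -/
lemma exists_hasPowerExpansion_gaussian {ι : Type*} [Countable ι] {lam : ι → ℝ} {mult : ι → ℕ}
    {d : ℕ} {h : ℂ → ℂ} (hh : AnalyticAt ℂ h 0)
    (hsum : ∀ w : ℂ, 0 < w.re →
      HasSum (fun i => (mult i : ℂ) * Complex.exp (-(lam i : ℂ) * w)) (h w / w ^ d)) :
    ∃ c : ℕ → ℝ, HasPowerExpansion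
      (fun ε => ε ^ d * ∑' i, (mult i : ℝ) * Real.exp (-(lam i * ε) ^ 2)) c := by
  have hnorm : ∀ i (w : ℂ), ‖(mult i : ℂ) * Complex.exp (-(lam i : ℂ) * w)‖ =
      (mult i : ℝ) * Real.exp (-lam i * w.re) := fun i w => by
    rw [norm_mul, Complex.norm_natCast, Complex.norm_exp]
    simp
  have hreal : ∀ y : ℝ, 0 < y →
      HasSum (fun i => (mult i : ℝ) * Real.exp (-lam i * y)) (h y / (y : ℂ) ^ d).re := by
    intro y hy
    have h1 := Complex.hasSum_re (hsum y (by simpa using hy))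
    refine h1.congr_fun fun i => ?_
    rw [← Complex.ofReal_neg, ← Complex.ofReal_mul, ← Complex.ofReal_exp, ← Complex.ofReal_natCast,
      ← Complex.ofReal_mul, Complex.ofReal_re]
  -- The absolute values of the terms depend only on Re w, so the sum is dominated by its value at
  -- Re w.
  have hle : ∀ w : ℂ, 0 < w.re → ‖h w / w ^ d‖ ≤ ‖h w.re / (w.re : ℂ) ^ d‖ := by
    intro w hw
    rw [← (hsum w hw).tsum_eq]
    refine (tsum_of_norm_bounded (hreal w.re hw) fun i => (hnorm i w).le).trans ?_
    exact Complex.re_le_norm _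
  obtain ⟨b, hb⟩ := hh.exists_taylor_bound
  set J : ℕ → ℂ := fun k => ∫ ξ : ℝ, lineTwo ξ ^ k / lineTwo ξ ^ d * lineWeight ξ with hJ
  set κ : ℂ := (Real.pi : ℂ) ^ (1 / 2 : ℂ) with hκ
  have hκ0 : κ ≠ 0 := by
    rw [hκ, Ne, Complex.cpow_eq_zero_iff]
    simp [Real.pi_ne_zero]
  refine ⟨fun k => (b k * J k / κ).re, hasPowerExpansion_of_exists_ge fun N =>
    ⟨N + d, by omega, ?_⟩⟩
  obtain ⟨C, δ, hC, hδ, hbound⟩ :=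
    exists_uniform_taylor_bound (N := N) (d := d) hh.continuousAt (hb (N + d)) hle
  set K : ℝ := ∫ ξ : ℝ, C * (‖lineTwo ξ‖ ^ N * Real.exp (1 - ξ ^ 2)) with hK
  refine Asymptotics.IsBigO.of_bound (K * ‖κ⁻¹‖) ?_
  filter_upwards [Ioo_mem_nhdsGT hδ] with ε hε
  obtain ⟨hε0, hεδ⟩ := hε
  have hεc : (ε : ℂ) ≠ 0 := by exact_mod_cast hε0.ne'
  have hre : ∀ ξ, ((ε : ℂ) * lineTwo ξ).re = 2 * ε := fun ξ => by simp [lineTwo_re, mul_comm]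
  have hre0 : ∀ ξ, 0 < ((ε : ℂ) * lineTwo ξ).re := fun ξ => by rw [hre]; positivity
  set F : ι → ℝ → ℂ := fun i ξ =>
    (mult i : ℂ) * Complex.exp (-(lam i : ℂ) * (ε * lineTwo ξ)) * lineWeight ξ with hF
  set f : ℝ → ℂ := fun ξ => h (ε * lineTwo ξ) / (ε * lineTwo ξ) ^ d * lineWeight ξ with hf
  have hFcont : ∀ i, Continuous (F i) := fun i => by
    have := continuous_lineTwo
    have := continuous_lineWeight
    fun_prop
  have hFnorm : ∀ i ξ, ‖F i ξ‖ =
      (mult i : ℝ) * Real.exp (-lam i * (2 * ε)) * Real.exp (1 - ξ ^ 2) := fun i ξ => by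
    rw [hF]
    simp only
    rw [norm_mul, hnorm, norm_lineWeight, hre]
  have hexp : Integrable fun ξ : ℝ => Real.exp (1 - ξ ^ 2) := by
    simpa using integrable_norm_lineTwo_pow_mul_exp 0
  have hFint : ∀ i, Integrable (F i) := fun i =>
    (hexp.const_mul ((mult i : ℝ) * Real.exp (-lam i * (2 * ε)))).mono'
      (hFcont i).aestronglyMeasurable (Eventually.of_forall fun ξ => (hFnorm i ξ).le)
  have hFsum : Summable fun i => ∫ ξ, ‖F i ξ‖ := by
    simp_rw [hFnorm, integral_const_mul]
    exact (hreal (2 * ε) (by positivity)).summable.mul_right _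
  have hFf : ∀ ξ, HasSum (fun i => F i ξ) (f ξ) := fun ξ =>
    (hsum _ (hre0 ξ)).mul_right _
  -- Regularity of h is assumed only at 0; measurability of f comes from its being a pointwise limit
  -- of finite sums of continuous functions.
  have hfmeas : AEStronglyMeasurable f volume :=
    aestronglyMeasurable_of_tendsto_ae atTop
      (f := fun (s : Finset ι) (ξ : ℝ) => ∑ i ∈ s, F i ξ)
      (fun s => (continuous_finsetSum s fun i _ => hFcont i).aestronglyMeasurable)
      (Eventually.of_forall fun ξ => hFf ξ)
  have hswap : HasSum (fun i => ((mult i : ℝ) * Real.exp (-(lam i * ε) ^ 2) : ℝ) * κ)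
      (∫ ξ, f ξ) := by
    have h1 := hasSum_integral_of_summable_integral_norm hFint hFsum
    have h2 : (fun ξ => ∑' i, F i ξ) = f := funext fun ξ => (hFf ξ).tsum_eq
    rw [h2] at h1
    refine h1.congr_fun fun i => ?_
    have h3 := integral_exp_lineTwo_mul_lineWeight (lam i * ε)
    rw [hF]
    simp only [mul_assoc]
    rw [integral_const_mul]
    push_cast at h3 ⊢
    simp only [neg_mul, mul_assoc] at h3 ⊢
    rw [h3]
    ring
  set Θ : ℝ := ∑' i, (mult i : ℝ) * Real.exp (-(lam i * ε) ^ 2) with hΘ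
  have hΘf : (Θ : ℂ) * κ = ∫ ξ, f ξ := by
    rw [← hswap.tsum_eq, tsum_mul_right, hΘ, Complex.ofReal_tsum]
  -- After multiplication by ε^d, D is the contribution of the Taylor remainder, and the T k carry
  -- no ε, so they integrate to the coefficients J k.
  set D : ℝ → ℂ := fun ξ => (h (ε * lineTwo ξ) -
    ∑ k ∈ Finset.range (N + d), b k * (ε * lineTwo ξ) ^ k) / lineTwo ξ ^ d * lineWeight ξ with hD
  set T : ℕ → ℝ → ℂ := fun k ξ => lineTwo ξ ^ k / lineTwo ξ ^ d * lineWeight ξ with hT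
  have hTcont : ∀ k, Continuous (T k) := fun k =>
    ((continuous_lineTwo.pow k).div (continuous_lineTwo.pow d)
      fun ξ => pow_ne_zero _ (lineTwo_ne_zero ξ)).mul continuous_lineWeight
  have hone : ∀ ξ, 1 ≤ ‖lineTwo ξ‖ := fun ξ => by
    have := Complex.re_le_norm (lineTwo ξ)
    rw [lineTwo_re] at this
    linarith
  have hTint : ∀ k, Integrable (T k) := fun k => by
    refine (integrable_norm_lineTwo_pow_mul_exp k).mono' (hTcont k).aestronglyMeasurable
      (Eventually.of_forall fun ξ => ?_)
    rw [hT]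
    simp only
    rw [norm_mul, norm_div, norm_pow, norm_pow, norm_lineWeight]
    gcongr
    exact div_le_self (by positivity) (one_le_pow₀ (hone ξ))
  have hsplit : ∀ ξ, (ε : ℂ) ^ d * f ξ =
      D ξ + ∑ k ∈ Finset.range (N + d), (b k * (ε : ℂ) ^ k) * T k ξ := by
    intro ξ
    have hv := lineTwo_ne_zero ξ
    have h1 : ∑ k ∈ Finset.range (N + d), (b k * (ε : ℂ) ^ k) * T k ξ =
        (∑ k ∈ Finset.range (N + d), b k * (ε * lineTwo ξ) ^ k) / lineTwo ξ ^ d *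
          lineWeight ξ := by
      rw [Finset.sum_div, Finset.sum_mul]
      refine Finset.sum_congr rfl fun k _ => ?_
      rw [hT]
      simp only
      ring
    rw [h1, hD, hf]
    simp only
    rw [mul_pow]
    field_simp
    ring
  have hDnorm : ∀ ξ, ‖D ξ‖ ≤ ε ^ N * (C * (‖lineTwo ξ‖ ^ N * Real.exp (1 - ξ ^ 2))) := by
    intro ξ
    have hv : 0 < ‖lineTwo ξ‖ := norm_pos_iff.2 (lineTwo_ne_zero ξ)
    rw [hD]
    simp only
    rw [norm_mul, norm_div, norm_pow, norm_lineWeight]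
    calc _ ≤ C * ε ^ N * ‖lineTwo ξ‖ ^ (N + d) / ‖lineTwo ξ‖ ^ d * Real.exp (1 - ξ ^ 2) := by
          gcongr
          exact hbound ε hε0 hεδ _ (lineTwo_re ξ)
      _ = _ := by rw [pow_add]; field_simp
  have hmaj := (integrable_norm_lineTwo_pow_mul_exp N).const_mul C
  have hsumint : Integrable fun ξ => ∑ k ∈ Finset.range (N + d), (b k * (ε : ℂ) ^ k) * T k ξ :=
    integrable_finsetSum _ fun k _ => (hTint k).const_mul _
  have hDint : Integrable D := by
    refine (hmaj.const_mul (ε ^ N)).mono' ?_ (Eventually.of_forall hDnorm)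
    have : D = fun ξ => (ε : ℂ) ^ d * f ξ -
        ∑ k ∈ Finset.range (N + d), (b k * (ε : ℂ) ^ k) * T k ξ := by
      funext ξ
      rw [hsplit]
      ring
    rw [this]
    exact (hfmeas.const_mul _).sub hsumint.aestronglyMeasurable
  have hfinal : (ε : ℂ) ^ d * (Θ * κ) =
      (∫ ξ, D ξ) + ∑ k ∈ Finset.range (N + d), (b k * (ε : ℂ) ^ k) * J k := by
    rw [hΘf, ← integral_const_mul]
    simp_rw [hsplit]
    rw [integral_add hDint hsumint, integral_finsetSum _ fun k _ => (hTint k).const_mul _]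
    simp_rw [integral_const_mul]
    rfl
  have hDle : ‖∫ ξ, D ξ‖ ≤ ε ^ N * K := by
    rw [hK, ← integral_const_mul]
    exact norm_integral_le_of_norm_le (hmaj.const_mul _) (Eventually.of_forall hDnorm)
  have hdiff : ((ε ^ d * Θ - ∑ k ∈ Finset.range (N + d), (b k * J k / κ).re * ε ^ k : ℝ)) =
      ((∫ ξ, D ξ) * κ⁻¹).re := by
    have h1 : (∫ ξ, D ξ) * κ⁻¹ = ((ε ^ d * Θ : ℝ) : ℂ) -
        ∑ k ∈ Finset.range (N + d), (b k * J k / κ) * ((ε ^ k : ℝ) : ℂ) := by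
      rw [eq_sub_of_add_eq hfinal.symm, sub_mul, Finset.sum_mul]
      push_cast
      congr 1
      · field_simp
      · exact Finset.sum_congr rfl fun k _ => by ring
    rw [h1, Complex.sub_re, Complex.ofReal_re, Complex.re_sum]
    simp only [Complex.re_mul_ofReal]
  rw [hdiff, Real.norm_of_nonneg (pow_nonneg hε0.le N), Real.norm_eq_abs]
  calc _ ≤ _ := Complex.abs_re_le_norm _
    _ = ‖∫ ξ, D ξ‖ * ‖κ⁻¹‖ := norm_mul _ _
    _ ≤ ε ^ N * K * ‖κ⁻¹‖ := by gcongr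
    _ = _ := by ring

/-! ### Operations on expansions, and the heat function of S_p. -/

lemma HasPowerExpansion.add {F G : ℝ → ℝ} {c e : ℕ → ℝ} (hF : HasPowerExpansion F c)
    (hG : HasPowerExpansion G e) :
    HasPowerExpansion (fun ε => F ε + G ε) (fun k => c k + e k) := fun N => by
  refine ((hF N).add (hG N)).congr_left fun ε => ?_
  simp only [add_mul, Finset.sum_add_distrib]
  ring

lemma exists_hasPowerExpansion_of_analyticAt {h : ℂ → ℂ} (hh : AnalyticAt ℂ h 0) :
    ∃ c : ℕ → ℝ, HasPowerExpansion (fun ε => (h ε).re) c := by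
  obtain ⟨b, hb⟩ := hh.exists_taylor_bound
  refine ⟨fun k => (b k).re, fun N => ?_⟩
  obtain ⟨r, hr, C, -, hC⟩ := hb N
  refine Asymptotics.IsBigO.of_bound C ?_
  filter_upwards [Ioo_mem_nhdsGT hr] with ε hε
  have hn : ‖(ε : ℂ)‖ = ε := by rw [Complex.norm_real, Real.norm_of_nonneg hε.1.le]
  have h1 := hC ε (by rw [hn]; exact hε.2)
  rw [hn] at h1
  rw [norm_pow, Real.norm_of_nonneg hε.1.le]
  refine le_trans (le_of_eq_of_le ?_ (Complex.abs_re_le_norm _)) h1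
  rw [Complex.sub_re, Complex.re_sum, Real.norm_eq_abs]
  congr 2
  refine Finset.sum_congr rfl fun k _ => ?_
  rw [← Complex.ofReal_pow, Complex.re_mul_ofReal]

lemma sum_range_sum_antidiagonal {M : Type*} [AddCommMonoid M] (f : ℕ × ℕ → M) (N : ℕ) :
    ∑ n ∈ Finset.range N, ∑ q ∈ Finset.HasAntidiagonal.antidiagonal n, f q =
      ∑ q ∈ (Finset.range N ×ˢ Finset.range N) with q.1 + q.2 < N, f q := by
  rw [← Finset.sum_fiberwise_of_maps_to (t := Finset.range N) (g := fun q : ℕ × ℕ => q.1 + q.2)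
    (fun q hq => Finset.mem_range.2 (Finset.mem_filter.1 hq).2)]
  refine Finset.sum_congr rfl fun n hn => Finset.sum_congr ?_ fun _ _ => rfl
  ext q
  simp only [Finset.HasAntidiagonal.mem_antidiagonal, Finset.mem_filter, Finset.mem_product, Finset.mem_range]
    at hn ⊢
  omega

lemma HasPowerExpansion.isBigO_one {F : ℝ → ℝ} {c : ℕ → ℝ} (hF : HasPowerExpansion F c) :
    F =O[𝓝[>] (0 : ℝ)] fun _ => (1 : ℝ) := by
  simpa using hF 0

lemma HasPowerExpansion.mul {F G : ℝ → ℝ} {c e : ℕ → ℝ} (hF : HasPowerExpansion F c)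
    (hG : HasPowerExpansion G e) :
    HasPowerExpansion (fun ε => F ε * G ε)
      (fun n => ∑ q ∈ Finset.HasAntidiagonal.antidiagonal n, c q.1 * e q.2) := fun N => by
  have h1 := ((hF N).mul hG.isBigO_one)
  have h2 := hF.isBigO_one.mul (hG N)
  have h3 := (hF N).mul (hG N)
  have h4 : (fun ε : ℝ => ∑ q ∈ (Finset.range N ×ˢ Finset.range N) with ¬ q.1 + q.2 < N,
      c q.1 * e q.2 * ε ^ (q.1 + q.2)) =O[𝓝[>] (0 : ℝ)] fun ε => ε ^ N :=
    Asymptotics.IsBigO.fun_sum fun q hq =>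
      (isBigO_pow_pow_nhdsGT (not_lt.1 (Finset.mem_filter.1 hq).2)).const_mul_left _
  simp only [mul_one, one_mul] at h1 h2
  have h3' := h3.trans ((isBigO_pow_pow_nhdsGT (m := N) (n := N + N) (by omega)).congr_left
    fun ε => pow_add ε N N)
  -- With A, B the truncations, FG - AB = (F - A)G + F(G - B) - (F - A)(G - B); `h4` absorbs the
  -- terms of AB of degree at least N.
  refine (((h1.add h2).sub h3').add h4).congr_left fun ε => ?_
  have hprod := Finset.sum_mul_sum (Finset.range N) (Finset.range N) (fun k => c k * ε ^ k)
    (fun k => e k * ε ^ k)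
  rw [← Finset.sum_product', ← Finset.sum_filter_add_sum_filter_not _
    (fun q : ℕ × ℕ => q.1 + q.2 < N)] at hprod
  have hsplit : ∀ q : ℕ × ℕ, c q.1 * ε ^ q.1 * (e q.2 * ε ^ q.2) =
      c q.1 * e q.2 * ε ^ (q.1 + q.2) := fun q => by rw [pow_add]; ring
  simp only [hsplit] at hprod
  have hdiag : ∑ n ∈ Finset.range N, (∑ q ∈ Finset.HasAntidiagonal.antidiagonal n, c q.1 * e q.2) * ε ^ n =
      ∑ n ∈ Finset.range N, ∑ q ∈ Finset.HasAntidiagonal.antidiagonal n, c q.1 * e q.2 * ε ^ (q.1 + q.2) := by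
    refine Finset.sum_congr rfl fun n _ => ?_
    rw [Finset.sum_mul]
    exact Finset.sum_congr rfl fun q hq => by rw [Finset.HasAntidiagonal.mem_antidiagonal.1 hq]
  rw [hdiag, sum_range_sum_antidiagonal]
  linear_combination -hprod

/-- Substituting `ε = √t` in an expansion in powers of `ε`. -/
lemma HasPowerExpansion.isBigO_rpow {Θ : ℝ → ℝ} {c : ℕ → ℝ} {d : ℕ}
    (h : HasPowerExpansion (fun ε => ε ^ d * Θ (ε ^ 2)) c) (N : ℕ) :
    (fun t : ℝ => Θ t - ∑ k ∈ Finset.range N, c k * t ^ (((k : ℝ) - d) / 2)) =O[𝓝[>] (0 : ℝ)]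
      fun t : ℝ => t ^ (((N : ℝ) - d) / 2) := by
  have hlim : Tendsto Real.sqrt (𝓝[>] (0 : ℝ)) (𝓝[>] (0 : ℝ)) := by
    refine tendsto_nhdsWithin_iff.2 ⟨?_, ?_⟩
    · have := (Real.continuous_sqrt.tendsto 0).mono_left (nhdsWithin_le_nhds (s := Set.Ioi 0))
      simpa using this
    · filter_upwards [self_mem_nhdsWithin] with t ht using Real.sqrt_pos.2 ht
  have h1 := ((h N).comp_tendsto hlim).mul
    (Asymptotics.isBigO_refl (fun t : ℝ => t ^ (-(d : ℝ) / 2)) (𝓝[>] (0 : ℝ)))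
  have hpow : ∀ t : ℝ, 0 < t → ∀ k : ℕ,
      Real.sqrt t ^ k * t ^ (-(d : ℝ) / 2) = t ^ (((k : ℝ) - d) / 2) := fun t ht k => by
    rw [Real.sqrt_eq_rpow, ← Real.rpow_natCast, ← Real.rpow_mul ht.le, ← Real.rpow_add ht]
    congr 1
    ring
  refine h1.congr' ?_ ?_
  · filter_upwards [self_mem_nhdsWithin] with t ht
    have ht' : 0 < t := ht
    simp only [Function.comp_apply, Real.sq_sqrt ht'.le]
    rw [sub_mul, Finset.sum_mul, mul_right_comm, hpow t ht', sub_self, zero_div, Real.rpow_zero,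
      one_mul]
    simp only [mul_assoc, hpow t ht']
  · filter_upwards [self_mem_nhdsWithin] with t ht
    exact hpow t ht N

lemma isLittleO_rpow_rpow_nhdsGT {u v : ℝ} (h : u < v) :
    (fun t : ℝ => t ^ v) =o[𝓝[>] (0 : ℝ)] fun t : ℝ => t ^ u := by
  refine Asymptotics.isLittleO_of_tendsto' ?_ ?_
  · filter_upwards [self_mem_nhdsWithin] with t ht h0
    exact absurd h0 (Real.rpow_pos_of_pos ht u).ne'
  · have h1 : Tendsto (fun t : ℝ => t ^ (v - u)) (𝓝[>] 0) (𝓝 0) := by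
      have := ((Real.continuousAt_rpow_const 0 (v - u) (Or.inr (by linarith))).tendsto).mono_left
        (nhdsWithin_le_nhds (s := Set.Ioi 0))
      rwa [Real.zero_rpow (by linarith)] at this
    refine h1.congr' ?_
    filter_upwards [self_mem_nhdsWithin] with t ht
    exact Real.rpow_sub ht v u

lemma HasPowerExpansion.hasPowerLogExpansion {f : ℝ → ℝ} {c : ℕ → ℝ} {d : ℕ}
    (h : HasPowerExpansion (fun ε => ε ^ d * f (ε ^ 2)) c) : HasPowerLogExpansion f := by
  refine ⟨fun k => ((k : ℝ) - d) / 2, fun _ => 0, fun k _ => c k, ?_, ?_, fun N => ?_⟩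
  · intro i j hij
    have : (i : ℝ) < j := by exact_mod_cast hij
    simp only
    linarith
  · exact (tendsto_atTop_add_const_right _ (-(d : ℝ)) tendsto_natCast_atTop_atTop).atTop_div_const
      two_pos
  · simp only [zero_add, Finset.range_one, Finset.sum_singleton, pow_zero, mul_one]
    -- The sum through index N has error of the order of the next power, which is o of the N-th.
    refine (h.isBigO_rpow (N + 1)).trans_isLittleO (isLittleO_rpow_rpow_nhdsGT ?_)
    push_cast
    linarith

/-- The sum `∑ mult i * exp (-(lam i) t)` of exponentials, the heat function without its constant
term. -/
noncomputable def theta {ι : Type*} (lam : ι → ℝ) (mult : ι → ℕ) (t : ℝ) : ℝ :=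
  ∑' i, (mult i : ℝ) * Real.exp (-lam i * t)

/-- exp(-(λ² + p)ε²) = exp(-pε²) exp(-(λε)²), so this is the Gaussian sum over L times an entire
function of ε. -/
lemma exists_hasPowerExpansion_theta_seqS {a x p : ℝ} (α : ℕ) (ha : 0 < a) :
    ∃ c : ℕ → ℝ, HasPowerExpansion
      (fun ε => ε ^ (α + 2) * theta (seqS a x p) (multN α) (ε ^ 2)) c := by
  obtain ⟨h, hh, hsum⟩ := exists_hasSum_exp_seqL (x := x) α ha
  obtain ⟨c, hc⟩ := exists_hasPowerExpansion_gaussian hh hsum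
  obtain ⟨e, he⟩ := exists_hasPowerExpansion_of_analyticAt
    (h := fun w : ℂ => Complex.exp (-p * w ^ 2)) (by fun_prop)
  obtain ⟨b, hb⟩ : ∃ b, HasPowerExpansion _ b := ⟨_, HasPowerExpansion.mul he hc⟩
  refine ⟨b, ?_⟩
  convert! hb using 2 with ε
  have h1 : (Complex.exp (-p * (ε : ℂ) ^ 2)).re = Real.exp (-p * ε ^ 2) := by
    rw [← Complex.exp_ofReal_re]
    push_cast
    rfl
  rw [h1, mul_left_comm, ← tsum_mul_left, theta]
  congr 1
  refine tsum_congr fun i => ?_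
  rw [mul_left_comm, ← Real.exp_add, seqS_eq]
  ring_nf

/-! ### Meromorphic continuation of Mellin transforms. -/

/-- `g` is meromorphic at `s` with at most a simple pole. -/
def HasAtMostSimplePole (g : ℂ → ℂ) (s : ℂ) : Prop :=
  MeromorphicAt g s ∧ -1 ≤ meromorphicOrderAt g s

lemma _root_.AnalyticAt.hasAtMostSimplePole {g : ℂ → ℂ} {s : ℂ} (h : AnalyticAt ℂ g s) :
    HasAtMostSimplePole g s :=
  ⟨h.meromorphicAt, le_trans (by decide) h.meromorphicOrderAt_nonneg⟩

lemma HasAtMostSimplePole.add {g₁ g₂ : ℂ → ℂ} {s : ℂ} (h₁ : HasAtMostSimplePole g₁ s)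
    (h₂ : HasAtMostSimplePole g₂ s) : HasAtMostSimplePole (fun z => g₁ z + g₂ z) s :=
  ⟨h₁.1.add h₂.1, (le_min h₁.2 h₂.2).trans (meromorphicOrderAt_add h₁.1 h₂.1)⟩

lemma HasAtMostSimplePole.analyticAt_mul {g f : ℂ → ℂ} {s : ℂ} (h : HasAtMostSimplePole g s)
    (hf : AnalyticAt ℂ f s) : HasAtMostSimplePole (fun z => f z * g z) s := by
  refine ⟨hf.meromorphicAt.mul h.1, ?_⟩
  have h1 : meromorphicOrderAt (fun z => f z * g z) s = _ :=
    meromorphicOrderAt_mul hf.meromorphicAt h.1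
  rw [h1]
  simpa using add_le_add hf.meromorphicOrderAt_nonneg h.2

lemma HasAtMostSimplePole.congr {g f : ℂ → ℂ} {s : ℂ} (h : HasAtMostSimplePole g s)
    (hfg : g =ᶠ[𝓝 s] f) : HasAtMostSimplePole f s := by
  have h1 := hfg.filter_mono (nhdsWithin_le_nhds (s := {s}ᶜ))
  exact ⟨h.1.congr h1, (meromorphicOrderAt_congr h1) ▸ h.2⟩

lemma HasAtMostSimplePole.sum {ι : Type*} {g : ι → ℂ → ℂ} {s : ℂ} (t : Finset ι)
    (h : ∀ i ∈ t, HasAtMostSimplePole (g i) s) :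
    HasAtMostSimplePole (fun z => ∑ i ∈ t, g i z) s := by
  classical
  induction t using Finset.induction_on with
  | empty => simpa using (analyticAt_const (v := (0 : ℂ))).hasAtMostSimplePole
  | insert i t hi ih =>
    simp only [Finset.sum_insert hi]
    exact (h i (Finset.mem_insert_self _ _)).add
      (ih fun j hj => h j (Finset.mem_insert_of_mem hj))

lemma hasAtMostSimplePole_div_add_const (c δ s : ℂ) :
    HasAtMostSimplePole (fun z => c * (1 / (z + δ))) s := by
  refine HasAtMostSimplePole.analyticAt_mul ?_ analyticAt_const
  by_cases h : s + δ = 0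
  · have h1 : (fun z : ℂ => 1 / (z + δ)) = fun z => (z - s)⁻¹ := by
      funext z
      rw [one_div, eq_neg_of_add_eq_zero_left h, sub_neg_eq_add]
    rw [h1]
    refine ⟨by fun_prop, ?_⟩
    have h2 : meromorphicOrderAt (fun z : ℂ => (z - s)⁻¹) s = _ :=
      meromorphicOrderAt_inv (f := fun z : ℂ => z - s)
    rw [h2, meromorphicOrderAt_id_sub_const]
  · have h1 : AnalyticAt ℂ (fun z : ℂ => 1 / (z + δ)) s :=
      analyticAt_const.div (g := fun z : ℂ => z + δ) (by fun_prop) h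
    exact h1.hasAtMostSimplePole

section Mellin

variable (f : ℝ → ℂ) (c : ℕ → ℂ) (d : ℕ)

/-- The function `f` minus the first `N` terms `c k * t ^ ((k - d) / 2)` on `(0, 1]`. -/
noncomputable def mellinRemainder (N : ℕ) (t : ℝ) : ℂ :=
  f t - ∑ k ∈ Finset.range N,
    c k * Set.indicator (Set.Ioc 0 1) (fun t : ℝ => (t : ℂ) ^ (((k : ℂ) - d) / 2)) t

/-- The continuation of the Mellin transform of `f` obtained from the first `N` terms of the
expansion of `f` at zero. -/
noncomputable def mellinContinuation (N : ℕ) (s : ℂ) : ℂ :=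
  mellin (mellinRemainder f c d N) s +
    ∑ k ∈ Finset.range N, c k * (1 / (s + ((k : ℂ) - d) / 2))

variable {f c d}

lemma mellinRemainder_zero : mellinRemainder f c d 0 = f :=
  funext fun t => by simp [mellinRemainder]

lemma mellinRemainder_succ (N : ℕ) (t : ℝ) : mellinRemainder f c d (N + 1) t =
    mellinRemainder f c d N t -
      c N • Set.indicator (Set.Ioc 0 1) (fun t : ℝ => (t : ℂ) ^ (((N : ℂ) - d) / 2)) t := by
  rw [mellinRemainder, mellinRemainder, Finset.sum_range_succ, smul_eq_mul]
  ring

variable {b : ℝ}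

lemma locallyIntegrableOn_mellinRemainder (hf : LocallyIntegrableOn f (Set.Ioi 0)) (N : ℕ) :
    LocallyIntegrableOn (mellinRemainder f c d N) (Set.Ioi 0) := by
  induction N with
  | zero =>
    rwa [mellinRemainder_zero]
  | succ N ih =>
    have h1 : ContinuousOn (fun t : ℝ => (t : ℂ) ^ (((N : ℂ) - d) / 2)) (Set.Ioi 0) :=
      fun t ht => (Complex.continuousAt_ofReal_cpow_const t _
        (Or.inr (ne_of_gt ht))).continuousWithinAt
    have h2 := h1.locallyIntegrableOn (μ := volume) measurableSet_Ioi
    have h3 : LocallyIntegrableOn (Set.indicator (Set.Ioc 0 1)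
        (fun t : ℝ => (t : ℂ) ^ (((N : ℂ) - d) / 2))) (Set.Ioi 0) := by
      intro t ht
      obtain ⟨U, hU, hi⟩ := h2 t ht
      exact ⟨U, hU, hi.indicator measurableSet_Ioc⟩
    have h4 : LocallyIntegrableOn (fun t => c N • Set.indicator (Set.Ioc 0 1)
        (fun t : ℝ => (t : ℂ) ^ (((N : ℂ) - d) / 2)) t) (Set.Ioi 0) := by
      intro t ht
      obtain ⟨U, hU, hi⟩ := h3 t ht
      exact ⟨U, hU, hi.smul (c N)⟩
    have h5 : mellinRemainder f c d (N + 1) = mellinRemainder f c d N -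
        fun t => c N • Set.indicator (Set.Ioc 0 1)
          (fun t : ℝ => (t : ℂ) ^ (((N : ℂ) - d) / 2)) t := funext (mellinRemainder_succ N)
    rw [h5]
    exact ih.sub h4

lemma isBigO_mellinRemainder_atTop (htop : f =O[atTop] fun t => Real.exp (-b * t)) (N : ℕ) :
    mellinRemainder f c d N =O[atTop] fun t => Real.exp (-b * t) := by
  refine htop.congr' ?_ EventuallyEq.rfl
  filter_upwards [eventually_gt_atTop 1] with t ht
  have : t ∉ Set.Ioc (0 : ℝ) 1 := fun h => absurd h.2 (not_le.2 ht)
  simp [mellinRemainder, this]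

lemma isBigO_mellinRemainder_nhdsGT
    (hbot : ∀ N : ℕ, (fun t : ℝ => f t - ∑ k ∈ Finset.range N,
      c k * (t : ℂ) ^ (((k : ℂ) - d) / 2)) =O[𝓝[>] (0 : ℝ)]
        fun t : ℝ => t ^ (((N : ℝ) - d) / 2)) (N : ℕ) :
    mellinRemainder f c d N =O[𝓝[>] (0 : ℝ)] fun t => t ^ (-(((d : ℝ) - N) / 2)) := by
  refine (hbot N).congr' ?_ ?_
  · filter_upwards [Ioc_mem_nhdsGT (one_pos : (0 : ℝ) < 1)] with t ht
    simp [mellinRemainder, ht]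
  · refine Eventually.of_forall fun t => ?_
    simp only
    congr 1
    ring

variable (hf : LocallyIntegrableOn f (Set.Ioi 0)) (hb : 0 < b)
  (htop : f =O[atTop] fun t => Real.exp (-b * t))
  (hbot : ∀ N : ℕ, (fun t : ℝ => f t - ∑ k ∈ Finset.range N,
    c k * (t : ℂ) ^ (((k : ℂ) - d) / 2)) =O[𝓝[>] (0 : ℝ)] fun t : ℝ => t ^ (((N : ℝ) - d) / 2))

include hf hb htop hbot

lemma mellinConvergent_mellinRemainder {N : ℕ} {s : ℂ} (hs : ((d : ℝ) - N) / 2 < s.re) :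
    MellinConvergent (mellinRemainder f c d N) s :=
  mellinConvergent_of_isBigO_rpow_exp hb (locallyIntegrableOn_mellinRemainder hf N)
    (isBigO_mellinRemainder_atTop htop N) (isBigO_mellinRemainder_nhdsGT hbot N) hs

/-- The Mellin transform of t^δ on (0, 1] is 1/(s + δ), so moving one term from the integral to the
explicit sum leaves the value unchanged. -/
lemma mellinContinuation_succ {N : ℕ} {s : ℂ} (hs : ((d : ℝ) - N) / 2 < s.re) :
    mellinContinuation f c d (N + 1) s = mellinContinuation f c d N s := by
  have hre : 0 < s.re + (((N : ℂ) - d) / 2).re := by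
    have : (((N : ℂ) - d) / 2) = (((N : ℝ) - d) / 2 : ℝ) := by push_cast; rfl
    rw [this, Complex.ofReal_re]
    linarith
  have h1 := hasMellin_cpow_Ioc (((N : ℂ) - d) / 2) hre
  have h2 := hasMellin_const_smul h1.1 (c N)
  have h3 := hasMellin_sub (mellinConvergent_mellinRemainder hf hb htop hbot hs) h2.1
  have h4 : mellinRemainder f c d (N + 1) = fun t => mellinRemainder f c d N t -
      c N • Set.indicator (Set.Ioc 0 1) (fun t : ℝ => (t : ℂ) ^ (((N : ℂ) - d) / 2)) t :=
    funext (mellinRemainder_succ N)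
  rw [mellinContinuation, mellinContinuation, Finset.sum_range_succ, h4, h3.2, h2.2, h1.2,
    smul_eq_mul]
  ring

lemma mellinContinuation_eq {M N : ℕ} (hMN : M ≤ N) {s : ℂ} (hs : ((d : ℝ) - M) / 2 < s.re) :
    mellinContinuation f c d N s = mellinContinuation f c d M s := by
  induction N, hMN using Nat.le_induction with
  | base => rfl
  | succ N hMN ih =>
    rw [mellinContinuation_succ hf hb htop hbot, ih]
    have : (M : ℝ) ≤ N := by exact_mod_cast hMN
    linarith

lemma hasAtMostSimplePole_mellinContinuation {N : ℕ} {s : ℂ} (hs : ((d : ℝ) - N) / 2 < s.re) :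
    HasAtMostSimplePole (mellinContinuation f c d N) s := by
  refine HasAtMostSimplePole.add (AnalyticAt.hasAtMostSimplePole ?_)
    (HasAtMostSimplePole.sum _ fun k _ => hasAtMostSimplePole_div_add_const _ _ _)
  have hopen : IsOpen {z : ℂ | ((d : ℝ) - N) / 2 < z.re} :=
    isOpen_lt continuous_const Complex.continuous_re
  refine DifferentiableOn.analyticAt (s := {z : ℂ | ((d : ℝ) - N) / 2 < z.re})
    (fun z hz => ?_) (hopen.mem_nhds hs)
  exact (mellin_differentiableAt_of_isBigO_rpow_exp hb (locallyIntegrableOn_mellinRemainder hf N)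
    (isBigO_mellinRemainder_atTop htop N) (isBigO_mellinRemainder_nhdsGT hbot N)
    hz).differentiableWithinAt

/-- The Mellin transform of a function with an expansion at zero in powers `t ^ ((k - d) / 2)` and
exponential decay at infinity continues meromorphically with at most simple poles. -/
lemma exists_mellin_continuation : ∃ M : ℂ → ℂ,
    (∀ s : ℂ, (d : ℝ) / 2 < s.re → M s = mellin f s) ∧ ∀ s, HasAtMostSimplePole M s := by
  -- Enough terms for the remainder integral to converge at s; the extra 1 makes the inequality
  -- strict.
  set n : ℂ → ℕ := fun s => ⌈(d : ℝ) - 2 * s.re⌉₊ + 1 with hn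
  have hn' : ∀ s : ℂ, ((d : ℝ) - n s) / 2 < s.re := fun s => by
    have := Nat.le_ceil ((d : ℝ) - 2 * s.re)
    rw [hn]
    push_cast
    linarith
  have hM : ∀ (N : ℕ) (s : ℂ), ((d : ℝ) - N) / 2 < s.re →
      mellinContinuation f c d N s = mellinContinuation f c d (n s) s := by
    intro N s hs
    rcases le_total N (n s) with h | h
    · exact (mellinContinuation_eq hf hb htop hbot h hs).symm
    · exact mellinContinuation_eq hf hb htop hbot h (hn' s)
  refine ⟨fun s => mellinContinuation f c d (n s) s, fun s hs => ?_, fun s => ?_⟩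
  · simp only
    rw [← hM 0 s (by simpa using hs)]
    simp [mellinContinuation, mellinRemainder_zero]
  · refine (hasAtMostSimplePole_mellinContinuation hf hb htop hbot (hn' s)).congr ?_
    filter_upwards [(isOpen_lt continuous_const Complex.continuous_re).mem_nhds (hn' s)] with z hz
    exact hM (n s) z hz

end Mellin

/-! ### Analytic properties of theta and its link with zeta. -/

section Theta

variable {ι : Type*} {lam : ι → ℝ} {mult : ι → ℕ}

lemma summable_exp_of_summable_div_pow (hpos : ∀ i, 0 < lam i)
    (hs : ∃ q : ℕ, Summable fun i => (mult i : ℝ) / lam i ^ (q + 1)) {t : ℝ} (ht : 0 < t) :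
    Summable fun i => (mult i : ℝ) * Real.exp (-lam i * t) := by
  obtain ⟨q, hq⟩ := hs
  refine Summable.of_nonneg_of_le (fun i => by positivity) (fun i => ?_)
    (hq.mul_left (((q + 1).factorial : ℝ) / t ^ (q + 1)))
  have hi := hpos i
  have h1 := Real.pow_div_factorial_le_exp (lam i * t) (by positivity) (q + 1)
  rw [neg_mul, Real.exp_neg]
  calc (mult i : ℝ) * (Real.exp (lam i * t))⁻¹
      ≤ mult i * ((lam i * t) ^ (q + 1) / ((q + 1).factorial : ℝ))⁻¹ := by gcongr
    _ = _ := by rw [mul_pow, inv_div]; field_simp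

lemma locallyIntegrableOn_theta (hpos : ∀ i, 0 < lam i)
    (hsum : ∀ t : ℝ, 0 < t → Summable fun i => (mult i : ℝ) * Real.exp (-lam i * t)) :
    LocallyIntegrableOn (fun t => (theta lam mult t : ℂ)) (Set.Ioi 0) := by
  have hanti : AntitoneOn (theta lam mult) (Set.Ioi 0) := by
    intro s hs t ht hst
    refine (hsum t ht).tsum_le_tsum (fun i => ?_) (hsum s hs)
    have hi := hpos i
    refine mul_le_mul_of_nonneg_left (Real.exp_le_exp.2 ?_) (Nat.cast_nonneg _)
    nlinarith
  rw [locallyIntegrableOn_iff isOpen_Ioi.isLocallyClosed]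
  intro K hK hKc
  exact ((hanti.mono hK).integrableOn_isCompact hKc).ofReal

lemma isBigO_theta_atTop {b : ℝ} (hb : ∀ i, b ≤ lam i)
    (hsum : ∀ t : ℝ, 0 < t → Summable fun i => (mult i : ℝ) * Real.exp (-lam i * t)) :
    (fun t => (theta lam mult t : ℂ)) =O[atTop] fun t => Real.exp (-b * t) := by
  refine Asymptotics.IsBigO.of_bound (theta lam mult 1 * Real.exp b) ?_
  filter_upwards [eventually_ge_atTop 1] with t ht
  have h0 : 0 ≤ theta lam mult t := tsum_nonneg fun i => by positivity
  rw [Complex.norm_real, Real.norm_of_nonneg h0, Real.norm_of_nonneg (Real.exp_pos _).le,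
    mul_assoc, ← Real.exp_add, theta, theta, ← tsum_mul_right]
  refine (hsum t (by linarith)).tsum_le_tsum (fun i => ?_) ((hsum 1 one_pos).mul_right _)
  rw [mul_assoc, ← Real.exp_add]
  refine mul_le_mul_of_nonneg_left (Real.exp_le_exp.2 ?_) (Nat.cast_nonneg _)
  nlinarith [hb i]

/-- The elements are bounded below by b > 0, so convergence at some τ < σ passes to σ at the cost of
a factor b^(-(σ - τ)). -/
lemma dirichletSummable_of_exponent_lt {b : ℝ} (hb0 : 0 < b) (hb : ∀ i, b ≤ lam i)
    (hfin : ∃ σ : ℝ, 0 ≤ σ ∧ DirichletSummable lam mult σ) {σ : ℝ}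
    (hσ : exponent lam mult < σ) : DirichletSummable lam mult σ := by
  obtain ⟨τ, ⟨-, hτ⟩, hτσ⟩ := exists_lt_of_csInf_lt hfin hσ
  refine Summable.of_nonneg_of_le (fun i => ?_) (fun i => ?_) (hτ.mul_left (b ^ (-(σ - τ))))
  · have := hb0.trans_le (hb i)
    positivity
  · have hi := hb0.trans_le (hb i)
    have h1 : lam i ^ (-σ) = lam i ^ (-(σ - τ)) * lam i ^ (-τ) := by
      rw [← Real.rpow_add hi]
      ring_nf
    rw [h1, mul_left_comm]
    exact mul_le_mul_of_nonneg_right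
      (Real.rpow_le_rpow_of_nonpos hb0 (hb i) (by linarith)) (by positivity)

/-- Termwise, the Mellin transform of exp(-λt) is Γ(s) λ^(-s). -/
lemma hasSum_zeta_of_dirichletSummable [Countable ι] (hpos : ∀ i, 0 < lam i)
    (hsum : ∀ t : ℝ, 0 < t → Summable fun i => (mult i : ℝ) * Real.exp (-lam i * t))
    {s : ℂ} (hs : 0 < s.re) (hD : DirichletSummable lam mult s.re) :
    HasSum (fun i => (mult i : ℂ) * (lam i : ℂ) ^ (-s))
      ((Complex.Gamma s)⁻¹ * mellin (fun t => (theta lam mult t : ℂ)) s) := by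
  have h1 := hasSum_mellin (a := fun i => (mult i : ℂ)) (p := lam)
    (F := fun t => (theta lam mult t : ℂ)) (fun i => Or.inr (hpos i)) hs
    (fun t ht => by
      have h := Complex.hasSum_ofReal.2 (hsum t ht).hasSum
      rw [theta]
      push_cast at h ⊢
      exact h)
    (by
      refine hD.congr fun i => ?_
      rw [Complex.norm_natCast, Real.rpow_neg (hpos i).le, div_eq_mul_inv])
  convert! h1.mul_left (Complex.Gamma s)⁻¹ using 1
  funext i
  have hG := Complex.Gamma_ne_zero_of_re_pos hs
  rw [Complex.cpow_neg]
  field_simp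

end Theta

/-! ### Assembly of both parts. -/

lemma isSpectralType_seqS (α : ℕ) (ha : 0 < a) (hx : 0 < a + 1 + x)
    (hp : 0 < (a + 1 + x) ^ 2 + p) : IsSpectralType (seqS a x p) (multN α) := by
  obtain ⟨c, C, hc, hC, hl, hu⟩ := exists_bounds_seqS ha hx hp
  refine ⟨inferInstance, fun i => hp.trans_le (seqS_ge ha hx i), multN_pos α,
    tendsto_of_pairSize_le hc two_ne_zero hl, ⟨(α : ℝ) + 2, by positivity, ?_⟩, ?_⟩
  · refine summable_of_pairSize_le hc (by positivity) hl ?_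
    push_cast
    linarith [Nat.cast_nonneg (α := ℝ) α]
  · obtain ⟨e, he⟩ := exists_hasPowerExpansion_theta_seqS (x := x) (p := p) α ha
    -- This handles the constant 1 of the heat function, which becomes ε^(α + 2) after scaling.
    obtain ⟨e', he'⟩ := exists_hasPowerExpansion_of_analyticAt
      (h := fun w : ℂ => w ^ (α + 2)) (by fun_prop)
    have h1 := he'.add he
    refine HasPowerExpansion.hasPowerLogExpansion (c := fun k => e' k + e k) (d := α + 2) ?_
    convert! h1 using 2 with ε
    rw [← Complex.ofReal_pow, Complex.ofReal_re, heat, mul_add, mul_one]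
    rfl

lemma isSimplyRegular_seqS (α : ℕ) (ha : 0 < a) (hx : 0 < a + 1 + x)
    (hp : 0 < (a + 1 + x) ^ 2 + p) : IsSimplyRegular (seqS a x p) (multN α) := by
  have hspec := isSpectralType_seqS α ha hx hp
  obtain ⟨c, C, hc, hC, hl, hu⟩ := exists_bounds_seqS ha hx hp
  have hsum : ∀ t : ℝ, 0 < t →
      Summable fun i => (multN α i : ℝ) * Real.exp (-seqS a x p i * t) := fun t ht =>
    summable_exp_of_summable_div_pow hspec.pos
      (exists_summable_div_pow_of_pairSize_le α hc two_ne_zero hl) ht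
  obtain ⟨e, he⟩ := exists_hasPowerExpansion_theta_seqS (x := x) (p := p) α ha
  have hbot : ∀ N : ℕ, (fun t : ℝ => (theta (seqS a x p) (multN α) t : ℂ) -
      ∑ k ∈ Finset.range N, (e k : ℂ) * (t : ℂ) ^ (((k : ℂ) - (α + 2 : ℕ)) / 2))
        =O[𝓝[>] (0 : ℝ)] fun t : ℝ => t ^ (((N : ℝ) - (α + 2 : ℕ)) / 2) := by
    intro N
    refine ((he.isBigO_rpow N).norm_left.congr' ?_ EventuallyEq.rfl).of_norm_left
    filter_upwards [self_mem_nhdsWithin] with t ht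
    have ht' : 0 < t := ht
    rw [← Complex.norm_real]
    push_cast
    simp only [Complex.ofReal_cpow ht'.le]
    push_cast
    rfl
  obtain ⟨M, hM, hpole⟩ := exists_mellin_continuation
    (locallyIntegrableOn_theta hspec.pos hsum) hp
    (isBigO_theta_atTop (seqS_ge ha hx) hsum) hbot
  have hZ : ∀ s, HasAtMostSimplePole (fun s => (Complex.Gamma s)⁻¹ * M s) s := fun s =>
    (hpole s).analyticAt_mul (Complex.differentiable_one_div_Gamma.analyticAt s)
  refine ⟨hspec, fun s => (Complex.Gamma s)⁻¹ * M s, fun s hs => ?_, fun s => (hZ s).1,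
    fun s => (hZ s).2⟩
  -- The continuation agrees with the Mellin integral only for Re s > (α + 2)/2, so the exponent
  -- must be bounded below by this number.
  have hexp := le_exponent_seqS α ha hx hp
  have hs2 : ((α : ℝ) + 2) / 2 < s.re := hexp.trans_lt hs
  simp only
  rw [hM s (by push_cast; exact hs2)]
  exact hasSum_zeta_of_dirichletSummable hspec.pos hsum (lt_trans (by positivity) hs2)
    (dirichletSummable_of_exponent_lt hp (seqS_ge ha hx) hspec.finite_exponent hs)

end SpectralSeq

theorem lemmas3 (a x p : ℝ) (α : ℕ) (ha : 0 < a)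
    (hx : ∀ m n : ℕ, 1 ≤ m → 1 ≤ n → 0 < a * (m : ℝ) + (n : ℝ) + x)
    (hp : ∀ m n : ℕ, 1 ≤ m → 1 ≤ n → 0 < (a * (m : ℝ) + (n : ℝ) + x) ^ 2 + p) :
    SpectralSeq.IsSimplyRegular (seqS a x p) (multN α) ∧
    ∀ z : ℂ,
      Multipliable (SpectralSeq.fredholmFactor (seqL a x) (multN α) z) ∧
      Multipliable (SpectralSeq.fredholmFactor (seqS a x 0) (multN α) z) ∧
      SpectralSeq.fredholm (seqL a x) (multN α) (Complex.I * z) *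
          SpectralSeq.fredholm (seqL a x) (multN α) (-Complex.I * z) =
        SpectralSeq.fredholm (seqS a x 0) (multN α) (z ^ 2) := by
  have hx' : 0 < a + 1 + x := by simpa using hx 1 1 le_rfl le_rfl
  have hp' : 0 < (a + 1 + x) ^ 2 + p := by simpa using hp 1 1 le_rfl le_rfl
  exact ⟨SpectralSeq.isSimplyRegular_seqS α ha hx' hp', fun z =>
    ⟨SpectralSeq.multipliable_fredholmFactor_seqL α ha hx' z,
      SpectralSeq.multipliable_fredholmFactor_seqS α ha hx' (by positivity) z,
      SpectralSeq.fredholm_seqL_mul α ha hx' z⟩⟩
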